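/- Let $q\in\mathbb C$ with $0<|q|<1$. Write $(x;q)_\infty=\prod_{j\ge 0}(1-xq^j)$, let $(x;q)_k=(x;q)_\infty/(xq^k;q)_\infty$ for $k\in\mathbb Z$, that is, $(x;q)_k=\prod_{j=0}^{k-1}(1-xq^j)$ for $k\ge 0$ and $(x;q)_{k}=\prod_{j=1}^{-k}(1-xq^{-j})^{-1}$ for $k<0$, write $(x_1,\dots,x_n;q)_k=\prod_i (x_i;q)_k$ for $k\in\mathbb Z\cup\{\infty\}$, and let $${}_n\psi_n\!\left[\begin{matrix}A_1,\dots,A_n\\B_1,\dots,B_n\end{matrix};q,z\right]=\sum_{k=-\infty}^{\infty}\frac{(A_1,\dots,A_n;q)_k}{(B_1,\dots,B_n;q)_k}z^k .$$ Such a series is called well-defined if no $A_i$ equals $q^{n}$ with $n\ge 1$ and no $B_i$ equals $q^{-n}$ with $n\ge 0$. It terminates from above (below) if all its terms of sufficiently large positive (negative) index vanish. Let $r\ge 1$, $s\ge 0$, let $m_1,\dots,m_s$ be nonnegative integers, $|m|=\sum_{i=1}^s m_i$, and let $a_1,\dots,a_r$, $b_1,\dots,b_r$, $c_1,\dots,c_r$,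 $h_1,\dots,h_s$, $z$ be complex numbers with all $a_i$, all $c_i$ and $z$ nonzero. Put $A=a_1\cdots a_r/(c_1\cdots c_r)$. Assume that neither $Az$ nor any $c_i/c_j$ with $i\ne j$ is an integer power of $q$, and that the series $$\Psi={}_{r+s}\psi_{r+s}\!\left[\begin{matrix}a_1,\dots,a_r,h_1q^{m_1},\dots,h_sq^{m_s}\\ b_1,\dots,b_r,h_1,\dots,h_s\end{matrix};q,z\right],$$ $$\Psi_j={}_{r+s}\psi_{r+s}\!\left[\begin{matrix}\frac{a_1q}{c_j},\dots,\frac{a_rq}{c_j},\frac{h_1q^{1+m_1}}{c_j},\dots,\frac{h_sq^{1+m_s}}{c_j}\\ \frac{b_1q}{c_j},\dots,\frac{b_rq}{c_j},\frac{h_1q}{c_j},\dots,\frac{h_sq}{c_j}\end{matrix};q,z\right]\quad(1\le j\le r)$$ are well-defined. Assume moreover that $$\left|\frac{b_1\cdots b_r\,q^{-|m|}}{a_1\cdots a_r}\right|<|z|<1,$$ where the upper bound $|z|<1$ may be dropped if all $r+1$ series $\Psi,\Psi_1,\dots,\Psi_r$ terminate from above, and the lower bound on $|z|$ may be dropped if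 they all terminate from below. Then all these series converge absolutely, and $$\Psi=\prod_{i=1}^s\frac{(h_iq/c_1;q)_{m_i}}{(h_i;q)_{m_i}}\cdot \frac{\left(\frac{c_1}{a_1},\dots,\frac{c_1}{a_r},c_2,\dots,c_r,\frac q{c_2},\dots,\frac q{c_r},\frac{b_1q}{c_1},\dots,\frac{b_rq}{c_1},Ac_1z,\frac q{Ac_1z};q\right)_{\infty}} {\left(\frac q{a_1},\dots,\frac q{a_r},\frac{c_1}{c_2},\dots,\frac{c_1}{c_r},\frac{c_2q}{c_1},\dots,\frac{c_rq}{c_1},b_1,\dots,b_r,Azq,\frac 1{Az};q\right)_{\infty}}\;\Psi_1 +\operatorname{idem}(c_1;c_2,\dots,c_r),$$ where $\operatorname{idem}(c_1;c_2,\dots,c_r)$ stands for the sum of the $r-1$ expressions obtained from the whole preceding expression on the right-hand side (including $\Psi_1$) by interchanging $c_1$ with each $c_k$, $k=2,\dots,r$. -/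

import Mathlib

noncomputable section

namespace ChuGasper

/-- The infinite `q`-shifted factorial `(a; q)_∞ = ∏_{j ≥ 0} (1 - a q^j)`. -/
def qInf (a q : ℂ) : ℂ := ∏' j : ℕ, (1 - a * q ^ j)

/-- The `q`-shifted factorial `(a; q)_k` for an integer `k`: `∏_{0 ≤ j < k} (1 - a q^j)` for `k ≥ 0`
and `1 / ∏_{1 ≤ j ≤ -k} (1 - a q^{-j})` for `k < 0`.  It equals `(a; q)_∞ / (a q^k; q)_∞` whenever
the latter makes sense, see `qPoch_eq_div`. -/
def qPoch (a q : ℂ) : ℤ → ℂ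
  | Int.ofNat n => ∏ j ∈ Finset.range n, (1 - a * q ^ j)
  | Int.negSucc n => (∏ j ∈ Finset.range (n + 1), (1 - a * q ^ (-((j : ℤ) + 1))))⁻¹

/-- The infinite product defining `(a; q)_∞` converges. -/
theorem multipliable_qInf (a : ℂ) {q : ℂ} (hq : ‖q‖ < 1) :
    Multipliable fun j : ℕ => (1 - a * q ^ j) := by
  have h : Summable fun j : ℕ => ‖-(a * q ^ j)‖ := by
    simpa [norm_mul, norm_pow] using
      (summable_geometric_of_lt_one (norm_nonneg q) hq).mul_left ‖a‖
  simpa [sub_eq_add_neg] using multipliable_one_add_of_summable h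

/-- Splitting off the first `n` factors of `(a; q)_∞`. -/
theorem qInf_eq_prod_mul (a : ℂ) {q : ℂ} (hq : ‖q‖ < 1) (n : ℕ) :
    qInf a q = (∏ j ∈ Finset.range n, (1 - a * q ^ j)) * qInf (a * q ^ n) q := by
  have e : ∀ j : ℕ, 1 - a * q ^ n * q ^ j = 1 - a * q ^ (j + n) := fun j => by ring
  have h : Multipliable fun j : ℕ => (1 - a * q ^ (j + n)) := by
    simpa only [e] using multipliable_qInf (a * q ^ n) hq
  unfold qInf
  simp only [e]
  exact (Multipliable.prod_mul_tprod_nat_mul' (f := fun j : ℕ => 1 - a * q ^ j) h).symm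

/-- The finite products defining `(a; q)_k` agree with `(a; q)_∞ / (a q^k; q)_∞`. -/
theorem qPoch_eq_div (a : ℂ) {q : ℂ} (hq0 : q ≠ 0) (hq : ‖q‖ < 1) (k : ℤ)
    (h : qInf (a * q ^ k) q ≠ 0) : qPoch a q k = qInf a q / qInf (a * q ^ k) q := by
  cases k with
  | ofNat n =>
    rw [eq_div_iff h]
    simpa [qPoch] using (qInf_eq_prod_mul a hq n).symm
  | negSucc n =>
    have e : a * q ^ (Int.negSucc n) * q ^ (n + 1) = a := by
      rw [zpow_negSucc, mul_assoc, inv_mul_cancel₀ (pow_ne_zero _ hq0), mul_one]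
    have h1 := qInf_eq_prod_mul (a * q ^ (Int.negSucc n)) hq (n + 1)
    rw [e, ← Finset.prod_range_reflect] at h1
    have h2 : ∏ j ∈ Finset.range (n + 1),
        (1 - a * q ^ (Int.negSucc n) * q ^ (n + 1 - 1 - j)) =
        ∏ j ∈ Finset.range (n + 1), (1 - a * q ^ (-((j : ℤ) + 1))) := by
      refine Finset.prod_congr rfl fun j hj => ?_
      have hj' : j ≤ n := Nat.lt_succ_iff.mp (Finset.mem_range.mp hj)
      rw [mul_assoc, ← zpow_natCast, ← zpow_add₀ hq0]
      congr 3
      rw [Int.negSucc_eq]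
      omega
    rw [h2] at h1
    have h3 : qInf a q ≠ 0 := fun h0 => by
      rw [h1] at h
      simp [h0] at h
    rw [h1]
    simp only [qPoch]
    field_simp

/-- The `k`-th term of the bilateral basic hypergeometric series `_nψ_n` with (finitely many) upper
parameters `A`, equally many lower parameters `B`, base `q` and argument `z`. -/
def psiTerm {ι : Type*} [Fintype ι] (q : ℂ) (A B : ι → ℂ) (z : ℂ) (k : ℤ) : ℂ :=
  (∏ i, qPoch (A i) q k) / (∏ i, qPoch (B i) q k) * z ^ k

/-- The bilateral basic hypergeometric series `_nψ_n [A; B; q, z]`, a sum over all integers. -/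
def psi {ι : Type*} [Fintype ι] (q : ℂ) (A B : ι → ℂ) (z : ℂ) : ℂ :=
  ∑' k : ℤ, psiTerm q A B z k

/-- The terms of `_nψ_n [A; B; q, z]` are well-defined: no factor `1 - A_i q^{-n}`, `n ≥ 1` (these
are in the denominators of the terms with negative index), and no factor `1 - B_i q^n`, `n ≥ 0`
(these are in the denominators of the terms with positive index), is zero. -/
def PsiWellDefined {ι : Type*} (q : ℂ) (A B : ι → ℂ) : Prop :=
  (∀ i, ∀ n : ℕ, A i ≠ q ^ (n + 1)) ∧ (∀ i, ∀ n : ℕ, B i * q ^ n ≠ 1)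

/-- A two-sided series terminates from above: its terms of large index vanish. -/
def TerminatesAbove (t : ℤ → ℂ) : Prop := ∃ N : ℤ, ∀ k : ℤ, N < k → t k = 0

/-- A two-sided series terminates from below: its terms of very negative index vanish. -/
def TerminatesBelow (t : ℤ → ℂ) : Prop := ∃ N : ℤ, ∀ k : ℤ, k < N → t k = 0

/-- The upper parameters `a_1, …, a_r, h_1 q^{m_1}, …, h_s q^{m_s}`. -/
def kmUpper {r s : ℕ} (q : ℂ) (a : Fin r → ℂ) (h : Fin s → ℂ) (m : Fin s → ℕ) :
    Fin r ⊕ Fin s → ℂ :=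
  Sum.elim a fun ν => h ν * q ^ m ν

/-- The lower parameters `b_1, …, b_r, h_1, …, h_s`. -/
def kmLower {r s : ℕ} (b : Fin r → ℂ) (h : Fin s → ℂ) : Fin r ⊕ Fin s → ℂ :=
  Sum.elim b h

/-- `T(c_1, …, c_r) + idem(c_1; c_2, …, c_r)`: the expression `T` plus the `r - 1` expressions
obtained from it by interchanging `c_1` with each of `c_2, …, c_r`. -/
def addIdem {r : ℕ} [NeZero r] (T : (Fin r → ℂ) → ℂ) (c : Fin r → ℂ) : ℂ :=
  T c + ∑ k ∈ Finset.univ.erase (0 : Fin r), T (c ∘ Equiv.swap 0 k)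

/-- The product in front of the first series on the right-hand side (`c 0` is `c_1`):
`∏_i (h_i q/c_1; q)_{m_i} / (h_i; q)_{m_i}` times the quotient of infinite products with numerator
`(c_1/a_1, …, c_1/a_r, c_2, …, c_r, q/c_2, …, q/c_r, b_1 q/c_1, …, b_r q/c_1, A c_1 z,
q/(A c_1 z); q)_∞` and denominator `(q/a_1, …, q/a_r, c_1/c_2, …, c_1/c_r, c_2 q/c_1, …, c_r q/c_1,
b_1, …, b_r, A z q, 1/(A z); q)_∞`, where `A = a_1 ⋯ a_r / (c_1 ⋯ c_r)`. -/
def prefactor {r s : ℕ} [NeZero r] (q : ℂ) (a b : Fin r → ℂ) (h : Fin s → ℂ) (m : Fin s → ℕ)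
    (z : ℂ) (c : Fin r → ℂ) : ℂ :=
  let A : ℂ := (∏ i, a i) / ∏ i, c i
  (∏ i, qPoch (h i * q / c 0) q (m i) / qPoch (h i) q (m i)) *
    (((∏ i, qInf (c 0 / a i) q) *
        (∏ i ∈ Finset.univ.erase (0 : Fin r), qInf (c i) q) *
        (∏ i ∈ Finset.univ.erase (0 : Fin r), qInf (q / c i) q) *
        (∏ i, qInf (b i * q / c 0) q) *
        qInf (A * c 0 * z) q * qInf (q / (A * c 0 * z)) q) /
      ((∏ i, qInf (q / a i) q) *
        (∏ i ∈ Finset.univ.erase (0 : Fin r), qInf (c 0 / c i) q) *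
        (∏ i ∈ Finset.univ.erase (0 : Fin r), qInf (c i * q / c 0) q) *
        (∏ i, qInf (b i) q) *
        qInf (A * z * q) q * qInf (1 / (A * z)) q))

/-- The upper parameters `a_1 q/x, …, a_r q/x, h_1 q^{1+m_1}/x, …, h_s q^{1+m_s}/x`. -/
def shiftedUpper {r s : ℕ} (q : ℂ) (a : Fin r → ℂ) (h : Fin s → ℂ) (m : Fin s → ℕ) (x : ℂ) :
    Fin r ⊕ Fin s → ℂ :=
  Sum.elim (fun i => a i * q / x) fun ν => h ν * q ^ (1 + m ν) / x

/-- The lower parameters `b_1 q/x, …, b_r q/x, h_1 q/x, …, h_s q/x`. -/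
def shiftedLower {r s : ℕ} (q : ℂ) (b : Fin r → ℂ) (h : Fin s → ℂ) (x : ℂ) :
    Fin r ⊕ Fin s → ℂ :=
  Sum.elim (fun i => b i * q / x) fun ν => h ν * q / x

end ChuGasper

end

/-! The formula is a residue theorem. Put `y = Az`, `N(x) = ∏ (b_i x, q/(a_i x); q)_∞ ∏ (h_i x;
q)_{m_i}`, `θ(x) = (x, q/x; q)_∞` and `F(x) = N(x) θ(x/y) / (θ(x) ∏ θ(c_i x))`. The
quasi-periodicity of `θ` makes `F(qx)/F(x)` the rational function `z ∏ (1 - A_i x)/(1 - B_i x)`,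
where `A`, `B` are the parameters of `Ψ`. This is the term ratio of `Ψ`, so along a family of poles
`p q^n` the residues of `F(x)/x` are proportional to the terms of the series with parameters scaled
by `p`: `p = 1` gives `Ψ` and `p = q/c_j` gives `Ψ_j`. The integrals of `F(x)/x` over circles of
radius `ρ|q|^n` tend to zero at both ends: the two bounds on `|z|` make `F` contract geometrically
near `0` and near `∞`. Hence all residues sum to zero (`sum_tsum_residues_eq_zero`), which is the
formula when no `c_j` is a power of `q` (`tsum_scaledTerm_eq_sum`).

If some `c_j` is a power of `q`, poles collide. But then every coefficient except the `j`-th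
contains the factor `θ(c_j) = 0`, and `Ψ_j` is an index shift of `Ψ`, so only one term ratio has to
be identified (`tsum_scaledTerm_eq_of_eq_zpow`); this needs no bound on `|z|`.

Terminating series need no separate argument. If all `r + 1` series terminate in the same direction,
a pigeonhole argument forces some `c_j` to be a power of `q` (`exists_eq_zpow_of_forall_exists`). -/

open Filter Topology

namespace ChuGasper

/-! ### Contour integrals and sums of residues -/

/-- The residue theorem for an annulus and finitely many simple poles. -/
theorem circleIntegral_sub_circleIntegral_eq_sum_residues {r R : ℝ} (hr : 0 < r) (hrR : r ≤ R)
    (res : ℂ → ℂ) (S : Finset ℂ) (hS : ∀ p ∈ S, r < ‖p‖ ∧ ‖p‖ < R) (f : ℂ → ℂ)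
    (hf : ∀ x : ℂ, r ≤ ‖x‖ → ‖x‖ ≤ R → x ∉ S → DifferentiableAt ℂ f x)
    (hres : ∀ p ∈ S, Tendsto (fun x => (x - p) * f x) (𝓝[≠] p) (𝓝 (res p))) :
    (∮ x in C(0, R), f x) - (∮ x in C(0, r), f x) = 2 * Real.pi * Complex.I * ∑ p ∈ S, res p := by
  classical
  have hR : 0 < R := hr.trans_le hrR
  induction S using Finset.induction_on generalizing f with
  | empty =>
    -- This theorem integrates `(x - 0)⁻¹ • g x`, so it is applied to `g x = x * f x`.
    have key := Complex.circleIntegral_sub_center_inv_smul_eq_of_differentiable_on_annulus_off_countable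
      (c := 0) hr hrR (f := fun x => x * f x) (s := ∅) Set.countable_empty
      (fun x hx => by
        simp only [Set.mem_sdiff, Metric.mem_closedBall, dist_zero_right, Metric.mem_ball,
          not_lt] at hx
        exact (differentiableAt_id.mul (hf x hx.2 hx.1 (by simp))).continuousAt.continuousWithinAt)
      (fun x hx => by
        simp only [Set.mem_sdiff, Metric.mem_closedBall, dist_zero_right, Metric.mem_ball,
          not_le, Set.mem_empty_iff_false, not_false_eq_true, and_true] at hx
        exact differentiableAt_id.mul (hf x hx.2.le hx.1.le (by simp)))
    have e : ∀ ρ : ℝ, 0 < ρ → (∮ x in C(0, ρ), (x - 0)⁻¹ • (x * f x)) = ∮ x in C(0, ρ), f x := by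
      intro ρ hρ
      refine circleIntegral.integral_congr hρ.le fun x hx => ?_
      have hx0 : x ≠ 0 := by
        rintro rfl
        simp at hx
        exact hρ.ne hx
      simp [hx0]
    rw [e R hR, e r hr] at key
    simp [key]
  | insert p S hpS ih =>
    obtain ⟨hp1, hp2⟩ := hS p (Finset.mem_insert_self p S)
    -- Removing the pole at `p`: `g` is analytic there by Riemann's theorem, so `dslope g p`, which
    -- is `f` minus its principal part at `p`, is holomorphic at `p` and falls under the induction
    -- hypothesis.
    set g : ℂ → ℂ := Function.update (fun x => (x - p) * f x) p (res p) with hg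
    have hgne : ∀ x, x ≠ p → g x = (x - p) * f x := fun x hx => by simp [hg, hx]
    have hgp : g p = res p := by simp [hg]
    have hgev : ∀ x, x ≠ p → g =ᶠ[𝓝 x] fun x => (x - p) * f x := fun x hx => by
      filter_upwards [isOpen_ne.mem_nhds hx] with y hy using hgne y hy
    have hgd : ∀ x : ℂ, r ≤ ‖x‖ → ‖x‖ ≤ R → x ∉ S → x ≠ p → DifferentiableAt ℂ g x :=
      fun x h1 h2 h3 h4 => by
        rw [(hgev x h4).differentiableAt_iff]
        exact (differentiableAt_id.sub_const p).mul (hf x h1 h2 (by simp [h3, h4]))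
    have hgc : ContinuousAt g p := by
      rw [continuousAt_update_same]
      exact hres p (Finset.mem_insert_self p S)
    have hga : AnalyticAt ℂ g p := by
      refine Complex.analyticAt_of_differentiable_on_punctured_nhds_of_continuousAt ?_ hgc
      have h1 : ∀ᶠ x : ℂ in 𝓝[≠] p, r < ‖x‖ :=
        (continuous_norm.continuousAt.eventually (lt_mem_nhds hp1)).filter_mono nhdsWithin_le_nhds
      have h2 : ∀ᶠ x : ℂ in 𝓝[≠] p, ‖x‖ < R :=
        (continuous_norm.continuousAt.eventually (gt_mem_nhds hp2)).filter_mono nhdsWithin_le_nhds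
      have h3 : ∀ᶠ x : ℂ in 𝓝[≠] p, x ∉ S :=
        (S.finite_toSet.isClosed.isOpen_compl.mem_nhds (by simpa using hpS) :
          (S : Set ℂ)ᶜ ∈ 𝓝 p) |> fun h => mem_nhdsWithin_of_mem_nhds h
      filter_upwards [h1, h2, h3, self_mem_nhdsWithin] with x h1 h2 h3 h4
      exact hgd x h1.le h2.le h3 h4
    set F : ℂ → ℂ := dslope g p with hF
    have hFne : ∀ x, x ≠ p → F x = f x - res p * (x - p)⁻¹ := fun x hx => by
      have : x - p ≠ 0 := sub_ne_zero.mpr hx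
      rw [hF, dslope_of_ne _ hx, slope_def_field, hgne x hx, hgp]
      field_simp
    have hFd : ∀ x : ℂ, r ≤ ‖x‖ → ‖x‖ ≤ R → x ∉ S → DifferentiableAt ℂ F x := by
      intro x h1 h2 h3
      by_cases hx : x = p
      · subst hx
        obtain ⟨P, hP⟩ := hga
        exact hP.has_fpower_series_dslope_fslope.analyticAt.differentiableAt
      · exact (differentiableAt_dslope_of_ne hx).mpr (hgd x h1 h2 h3 hx)
    have hFres : ∀ s ∈ S, Tendsto (fun x => (x - s) * F x) (𝓝[≠] s) (𝓝 (res s)) := by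
      intro s hs
      have hsp : s ≠ p := fun e => hpS (e ▸ hs)
      have h1 := hres s (Finset.mem_insert_of_mem hs)
      have h2 : Tendsto (fun x => (x - s) * (res p * (x - p)⁻¹)) (𝓝[≠] s) (𝓝 0) := by
        have : ContinuousAt (fun x => (x - s) * (res p * (x - p)⁻¹)) s := by
          have : s - p ≠ 0 := sub_ne_zero.mpr hsp
          fun_prop (disch := assumption)
        have h3 := this.tendsto
        rw [sub_self, zero_mul] at h3
        exact h3.mono_left nhdsWithin_le_nhds
      have h3 := h1.sub h2
      rw [sub_zero] at h3
      refine h3.congr' ?_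
      filter_upwards [mem_nhdsWithin_of_mem_nhds (isOpen_ne.mem_nhds hsp)] with x hx
      rw [hFne x hx]
      ring
    have key := ih (fun s hs => hS s (Finset.mem_insert_of_mem hs)) F hFd hFres
    have hcirc : ∀ ρ : ℝ, 0 < ρ → r ≤ ρ → ρ ≤ R → ‖p‖ ≠ ρ → (∀ s ∈ S, ‖s‖ ≠ ρ) →
        (∮ x in C(0, ρ), f x) = (∮ x in C(0, ρ), F x) + res p * ∮ x in C(0, ρ), (x - p)⁻¹ := by
      intro ρ hρ h1 h2 hpρ hsρ
      have hne : ∀ x ∈ Metric.sphere (0 : ℂ) ρ, x ≠ p := by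
        rintro x hx rfl
        simp at hx
        exact hpρ hx
      rw [← smul_eq_mul, ← circleIntegral.integral_smul, ← circleIntegral.integral_add]
      · refine circleIntegral.integral_congr hρ.le fun x hx => ?_
        simp only [smul_eq_mul]
        rw [hFne x (hne x hx)]
        ring
      · refine ContinuousOn.circleIntegrable hρ.le fun x hx => ?_
        have hx' : ‖x‖ = ρ := by simpa using hx
        refine (hFd x (by linarith) (by linarith)
          fun h => hsρ x h hx').continuousAt.continuousWithinAt
      · refine ContinuousOn.circleIntegrable hρ.le fun x hx => ?_
        have : x - p ≠ 0 := sub_ne_zero.mpr (hne x hx)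
        apply ContinuousAt.continuousWithinAt
        fun_prop (disch := assumption)
    rw [hcirc R hR hrR le_rfl hp2.ne fun s hs => (hS s (Finset.mem_insert_of_mem hs)).2.ne,
      hcirc r hr le_rfl hrR hp1.ne' fun s hs => (hS s (Finset.mem_insert_of_mem hs)).1.ne',
      circleIntegral.integral_sub_inv_of_mem_ball (by simpa using hp2), Finset.sum_insert hpS]
    have h0 : (∮ x in C(0, r), (x - p)⁻¹) = 0 := by
      refine Complex.circleIntegral_eq_zero_of_differentiable_on_off_countable hr.le
        Set.countable_empty (fun x hx => ?_) fun x hx => ?_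
      all_goals
        have hx' : ‖x‖ ≤ r := by
          first
          | simpa using hx
          | exact (by simpa using hx : ‖x‖ < r).le
        have : x - p ≠ 0 := by
          refine sub_ne_zero.mpr ?_
          rintro rfl
          linarith
      · apply ContinuousAt.continuousWithinAt
        fun_prop (disch := assumption)
      · fun_prop (disch := assumption)
    rw [h0]
    linear_combination key

/-- Circle integrals over `‖x‖ = ρ ‖q‖ ^ n` of `f x / x` tend to zero if the values of `f` on these
circles eventually decrease geometrically. -/
theorem tendsto_circleIntegral_div_of_contracting {f : ℂ → ℂ} {R : ℕ → ℝ} (hR : ∀ n, 0 < R n)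
    {c M : ℝ} (hc0 : 0 ≤ c) (hc : c < 1) (n₀ : ℕ)
    (hM : ∀ x : ℂ, ‖x‖ = R n₀ → ‖f x‖ ≤ M)
    (hstep : ∀ n, n₀ ≤ n → ∀ x : ℂ, ‖x‖ = R (n + 1) → ∃ y : ℂ, ‖y‖ = R n ∧ ‖f x‖ ≤ c * ‖f y‖) :
    Tendsto (fun n => ∮ x in C(0, R n), x⁻¹ * f x) atTop (𝓝 0) := by
  have hbd : ∀ k : ℕ, ∀ x : ℂ, ‖x‖ = R (n₀ + k) → ‖f x‖ ≤ M * c ^ k := by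
    intro k
    induction k with
    | zero => intro x hx; simpa using hM x hx
    | succ k ih =>
      intro x hx
      obtain ⟨y, hy, hxy⟩ := hstep (n₀ + k) (by omega) x hx
      calc ‖f x‖ ≤ c * ‖f y‖ := hxy
        _ ≤ c * (M * c ^ k) := by gcongr; exact ih y hy
        _ = M * c ^ (k + 1) := by ring
  have hint : ∀ k : ℕ, ‖∮ x in C(0, R (n₀ + k)), x⁻¹ * f x‖ ≤ 2 * Real.pi * (M * c ^ k) := by
    intro k
    have := circleIntegral.norm_integral_le_of_norm_le_const (c := 0) (hR (n₀ + k)).le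
      (f := fun x => x⁻¹ * f x) (C := (R (n₀ + k))⁻¹ * (M * c ^ k)) fun x hx => by
        have hx' : ‖x‖ = R (n₀ + k) := by simpa using hx
        rw [norm_mul, norm_inv, hx']
        have := (hR (n₀ + k)).le
        gcongr
        exact hbd k x hx'
    refine this.trans_eq ?_
    have := (hR (n₀ + k)).ne'
    field_simp
  have hlim : Tendsto (fun k : ℕ => 2 * Real.pi * (M * c ^ k)) atTop (𝓝 0) := by
    simpa using ((tendsto_pow_atTop_nhds_zero_of_lt_one hc0 hc).const_mul M).const_mul
      (2 * Real.pi)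
  rw [← tendsto_add_atTop_iff_nat n₀]
  simp only [add_comm _ n₀]
  exact squeeze_zero_norm hint hlim

/-- The sum of a two-sided sequence of differences of a sequence vanishing at both ends is zero. -/
theorem tsum_int_sub_succ_eq_zero {J : ℤ → ℂ} (hs : Summable fun n => J n - J (n + 1))
    (htop : Tendsto (fun n : ℕ => J n) atTop (𝓝 0))
    (hbot : Tendsto (fun n : ℕ => J (-(n : ℤ))) atTop (𝓝 0)) :
    ∑' n, (J n - J (n + 1)) = 0 := by
  have s1 : Summable fun n : ℕ => J n - J ((n : ℤ) + 1) :=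
    hs.comp_injective (i := fun n : ℕ => (n : ℤ)) Nat.cast_injective
  have s2 : Summable fun n : ℕ => J (-((n : ℤ) + 1)) - J (-((n : ℤ) + 1) + 1) :=
    hs.comp_injective (i := fun n : ℕ => (-((n : ℤ) + 1))) fun a b hab => by
      simp only at hab; omega
  rw [tsum_of_nat_of_neg_add_one (f := fun n => J n - J (n + 1)) s1 s2]
  have e1 : ∑' n : ℕ, (J n - J ((n : ℤ) + 1)) = J 0 := by
    refine tendsto_nhds_unique s1.hasSum.tendsto_sum_nat ?_
    have : ∀ N : ℕ, ∑ n ∈ Finset.range N, (J n - J ((n : ℤ) + 1)) = J 0 - J N := fun N => by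
      simpa using Finset.sum_range_sub' (fun n : ℕ => J n) N
    simp only [this]
    simpa using htop.const_sub (J 0)
  have e2 : ∑' n : ℕ, (J (-((n : ℤ) + 1)) - J (-((n : ℤ) + 1) + 1)) = -J 0 := by
    refine tendsto_nhds_unique s2.hasSum.tendsto_sum_nat ?_
    have : ∀ N : ℕ, ∑ n ∈ Finset.range N, (J (-((n : ℤ) + 1)) - J (-((n : ℤ) + 1) + 1)) =
        J (-(N : ℤ)) - J 0 := fun N => by
      simpa using Finset.sum_range_sub (fun n : ℕ => J (-(n : ℤ))) N
    simp only [this]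
    simpa using hbot.sub_const (J 0)
  rw [e1, e2, add_neg_cancel]

section

variable {κ : Type*} [Fintype κ] {q : ℂ} {φ : ℂ → ℂ} {p : κ → ℂ} {w : κ → ℤ → ℂ}

/-- `sum_tsum_residues_eq_zero` when all `p j` lie in one annulus `ρ ‖q‖ < ‖x‖ < ρ`. -/
theorem sum_tsum_residues_eq_zero_of_mem_annulus (hq0 : q ≠ 0) (hq1 : ‖q‖ < 1)
    {ρ : ℝ} (hρ : 0 < ρ) (hp : ∀ j, ρ * ‖q‖ < ‖p j‖ ∧ ‖p j‖ < ρ) (hinj : Function.Injective p)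
    (hdiff : ∀ x, x ≠ 0 → (∀ j, ∀ n : ℤ, x ≠ p j * q ^ n) → DifferentiableAt ℂ φ x)
    (hlim : ∀ j, ∀ n : ℤ, Tendsto (fun x => (1 - x / (p j * q ^ n)) * φ x)
      (𝓝[≠] (p j * q ^ n)) (𝓝 (w j n)))
    (hsum : ∀ j, Summable (w j))
    (hzero : ∃ δ > 0, ∃ c < 1, ∀ x, x ≠ 0 → ‖x‖ < δ → ‖φ (q * x)‖ ≤ c * ‖φ x‖)
    (hinf : ∃ M : ℝ, ∃ c < 1, ∀ x, M < ‖x‖ → ‖φ x‖ ≤ c * ‖φ (q * x)‖) :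
    ∑ j, ∑' n, w j n = 0 := by
  classical
  have hqp : 0 < ‖q‖ := norm_pos_iff.mpr hq0
  have hanti : StrictAnti fun n : ℤ => ‖q‖ ^ n := zpow_right_strictAnti₀ hqp hq1
  set R : ℤ → ℝ := fun n => ρ * ‖q‖ ^ n with hRdef
  have hRpos : ∀ n, 0 < R n := fun n => by positivity
  have hRsucc : ∀ n, R (n + 1) = R n * ‖q‖ := fun n => by
    simp only [hRdef, zpow_add_one₀ hqp.ne']; ring
  have hpole : ∀ j n, R (n + 1) < ‖p j * q ^ n‖ ∧ ‖p j * q ^ n‖ < R n := fun j n => by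
    have h1 : 0 < ‖q‖ ^ n := by positivity
    rw [hRsucc, norm_mul, norm_zpow]
    simp only [hRdef]
    constructor
    · nlinarith [(hp j).1]
    · nlinarith [(hp j).2]
  have hRanti : ∀ {m n : ℤ}, m ≤ n → R n ≤ R m := fun hmn =>
    mul_le_mul_of_nonneg_left (hanti.antitone hmn) hρ.le
  -- The closed annulus between `R (n + 1)` and `R n` meets each family of poles only in its `n`-th
  -- member.
  have hoff : ∀ (n k : ℤ) (j : κ) (x : ℂ), R (n + 1) ≤ ‖x‖ → ‖x‖ ≤ R n → x = p j * q ^ k →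
      k = n := by
    rintro n k j x h1 h2 rfl
    obtain ⟨h3, h4⟩ := hpole j k
    by_contra hkn
    rcases lt_or_gt_of_ne hkn with h | h
    · have := hRanti (show k + 1 ≤ n by omega); linarith
    · have := hRanti (show n + 1 ≤ k by omega); linarith
  have hcirc : ∀ (n : ℤ) (x : ℂ), ‖x‖ = R n → DifferentiableAt ℂ φ x := by
    intro n x hx
    have hx0 : x ≠ 0 := norm_pos_iff.mp (hx ▸ hRpos n)
    refine hdiff x hx0 fun j k hk => ?_
    have h1 := hoff n k j x (hx ▸ hRanti (by omega)) hx.le hk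
    have h2 := (hpole j k).2
    rw [← hk, hx, h1] at h2
    exact lt_irrefl _ h2
  have hbound : ∀ n : ℤ, ∃ M, ∀ x : ℂ, ‖x‖ = R n → ‖φ x‖ ≤ M := by
    intro n
    obtain ⟨M, hM⟩ := (isCompact_sphere (0 : ℂ) (R n)).exists_bound_of_continuousOn (f := φ)
      fun x hx => (hcirc n x (by simpa using hx)).continuousAt.continuousWithinAt
    exact ⟨M, fun x hx => hM x (by simpa using hx)⟩
  set J : ℤ → ℂ := fun n => ∮ x in C(0, R n), x⁻¹ * φ x with hJ
  have hJdiff : ∀ n, J n - J (n + 1) = -(2 * Real.pi * Complex.I) * ∑ j, w j n := by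
    intro n
    have hinjn : Function.Injective fun j => p j * q ^ n := fun i j hij =>
      hinj (mul_right_cancel₀ (zpow_ne_zero n hq0) hij)
    -- The residue theorem takes residues as a function of the point, not of `j`; `limUnder`
    -- supplies one. The sign arises from `(x - P) x⁻¹ = -P x⁻¹ (1 - x / P)`, whose factor `-P x⁻¹`
    -- tends to `-1`.
    have hres : ∀ P ∈ Finset.univ.image fun j => p j * q ^ n,
        Tendsto (fun x => (x - P) * (x⁻¹ * φ x)) (𝓝[≠] P)
          (𝓝 (limUnder (𝓝[≠] P) fun x => (x - P) * (x⁻¹ * φ x))) ∧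
        ∀ j, P = p j * q ^ n →
          limUnder (𝓝[≠] P) (fun x => (x - P) * (x⁻¹ * φ x)) = -w j n := by
      intro P hP
      have hT : ∀ j, P = p j * q ^ n →
          Tendsto (fun x => (x - P) * (x⁻¹ * φ x)) (𝓝[≠] P) (𝓝 (-w j n)) := by
        rintro j rfl
        have hP0 : p j * q ^ n ≠ 0 := norm_pos_iff.mp ((hRpos _).trans (hpole j n).1)
        have h1 : Tendsto (fun x : ℂ => -(p j * q ^ n) * x⁻¹) (𝓝[≠] (p j * q ^ n)) (𝓝 (-1)) := by
          have : ContinuousAt (fun x : ℂ => -(p j * q ^ n) * x⁻¹) (p j * q ^ n) := by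
            fun_prop (disch := assumption)
          have h2 := this.tendsto
          rw [neg_mul, mul_inv_cancel₀ hP0] at h2
          exact h2.mono_left nhdsWithin_le_nhds
        have h2 := h1.mul (hlim j n)
        rw [neg_one_mul] at h2
        refine h2.congr fun x => ?_
        linear_combination x⁻¹ * φ x * div_mul_cancel₀ x hP0
      obtain ⟨j, -, rfl⟩ := Finset.mem_image.mp hP
      refine ⟨?_, fun i hi => (hT i hi).limUnder_eq⟩
      rw [(hT j rfl).limUnder_eq]
      exact hT j rfl
    have key := circleIntegral_sub_circleIntegral_eq_sum_residues (hRpos (n + 1))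
      (hRanti (show n ≤ n + 1 by omega)) _ (Finset.univ.image fun j => p j * q ^ n)
      (fun P hP => by
        obtain ⟨j, -, rfl⟩ := Finset.mem_image.mp hP
        exact hpole j n)
      (fun x => x⁻¹ * φ x)
      (fun x h1 h2 h3 => by
        have hx0 : x ≠ 0 := norm_pos_iff.mp ((hRpos _).trans_le h1)
        refine (differentiableAt_inv hx0).mul (hdiff x hx0 fun j k hk => h3 ?_)
        obtain rfl := hoff n k j x h1 h2 hk
        exact Finset.mem_image.mpr ⟨j, Finset.mem_univ j, hk.symm⟩)
      (fun P hP => (hres P hP).1)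
    rw [Finset.sum_image fun i _ j _ hij => hinjn hij,
      Finset.sum_congr rfl fun j _ =>
        (hres _ (Finset.mem_image_of_mem _ (Finset.mem_univ j))).2 j rfl,
      Finset.sum_neg_distrib] at key
    simp only [hJ]
    rw [key]
    ring
  have htop : Tendsto (fun n : ℕ => J n) atTop (𝓝 0) := by
    obtain ⟨δ, hδ, c, hc, h⟩ := hzero
    have hlimR : Tendsto (fun n : ℕ => R n) atTop (𝓝 0) := by
      simpa [hRdef] using (tendsto_pow_atTop_nhds_zero_of_lt_one hqp.le hq1).const_mul ρ
    obtain ⟨n₀, hn₀⟩ := (hlimR.eventually (gt_mem_nhds hδ)).exists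
    obtain ⟨M, hM⟩ := hbound n₀
    -- The given constant `c` may be negative, hence `max c 0`.
    refine tendsto_circleIntegral_div_of_contracting (R := fun n : ℕ => R n)
      (fun n => hRpos n) (le_max_right c 0) (max_lt hc one_pos) n₀ hM fun n hn x hx => ?_
    have hy : ‖q⁻¹ * x‖ = R n := by
      rw [norm_mul, norm_inv, hx, Nat.cast_add, Nat.cast_one, hRsucc]
      field_simp
    refine ⟨q⁻¹ * x, hy, ?_⟩
    have h1 := h (q⁻¹ * x) (norm_pos_iff.mp (hy ▸ hRpos n)) (by
      rw [hy]
      exact (hRanti (by exact_mod_cast hn)).trans_lt hn₀)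
    rw [mul_inv_cancel_left₀ hq0] at h1
    exact h1.trans (mul_le_mul_of_nonneg_right (le_max_left _ _) (norm_nonneg _))
  have hbot : Tendsto (fun n : ℕ => J (-(n : ℤ))) atTop (𝓝 0) := by
    obtain ⟨B, c, hc, h⟩ := hinf
    have hlimR : Tendsto (fun n : ℕ => R (-(n : ℤ))) atTop atTop := by
      have h1 : Tendsto (fun n : ℕ => ρ * (‖q‖⁻¹) ^ n) atTop atTop :=
        (tendsto_pow_atTop_atTop_of_one_lt ((one_lt_inv₀ hqp).mpr hq1)).const_mul_atTop hρ
      simpa [hRdef] using h1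
    obtain ⟨n₀, hn₀⟩ := (hlimR.eventually (eventually_gt_atTop B)).exists
    obtain ⟨M, hM⟩ := hbound (-(n₀ : ℤ))
    refine tendsto_circleIntegral_div_of_contracting (R := fun n : ℕ => R (-(n : ℤ)))
      (fun n => hRpos _) (le_max_right c 0) (max_lt hc one_pos) n₀ hM fun n hn x hx => ?_
    refine ⟨q * x, ?_, ?_⟩
    · rw [norm_mul, hx, mul_comm, ← hRsucc]
      congr 1
      push_cast
      ring
    · have h1 := h x (by
        rw [hx]
        exact hn₀.trans_le (hRanti (by omega)))
      exact h1.trans (mul_le_mul_of_nonneg_right (le_max_left _ _) (norm_nonneg _))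
  have hJs : Summable fun n => J n - J (n + 1) := by
    simp only [hJdiff]
    exact (summable_sum fun j _ => hsum j).mul_left _
  have h0 := tsum_int_sub_succ_eq_zero hJs htop hbot
  simp only [hJdiff] at h0
  rw [tsum_mul_left, Summable.tsum_finsetSum fun j _ => hsum j] at h0
  refine (mul_eq_zero.mp h0).resolve_left ?_
  simp [Real.pi_ne_zero, Complex.I_ne_zero]

/-- If `φ` has only simple poles in `ℂ \ {0}`, at the points `p j * q ^ n`, and
decreases geometrically along `q ^ n` as `n → ±∞`, then its residues sum to zero. -/
theorem sum_tsum_residues_eq_zero (hq0 : q ≠ 0) (hq1 : ‖q‖ < 1)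
    (hp : ∀ j, p j ≠ 0) (hpp : ∀ i j, i ≠ j → ∀ n : ℤ, p i ≠ p j * q ^ n)
    (hdiff : ∀ x, x ≠ 0 → (∀ j, ∀ n : ℤ, x ≠ p j * q ^ n) → DifferentiableAt ℂ φ x)
    (hlim : ∀ j, ∀ n : ℤ, Tendsto (fun x => (1 - x / (p j * q ^ n)) * φ x)
      (𝓝[≠] (p j * q ^ n)) (𝓝 (w j n)))
    (hsum : ∀ j, Summable (w j))
    (hzero : ∃ δ > 0, ∃ c < 1, ∀ x, x ≠ 0 → ‖x‖ < δ → ‖φ (q * x)‖ ≤ c * ‖φ x‖)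
    (hinf : ∃ M : ℝ, ∃ c < 1, ∀ x, M < ‖x‖ → ‖φ x‖ ≤ c * ‖φ (q * x)‖) :
    ∑ j, ∑' n, w j n = 0 := by
  have hqp : 0 < ‖q‖ := norm_pos_iff.mpr hq0
  -- The poles have countably many moduli; avoiding them keeps every circle of radius `ρ‖q‖^n` free
  -- of poles and makes the inequalities in `hk` strict. Replacing `p j` by `p j * q ^ k j` only
  -- reindexes its family.
  obtain ⟨ρ, hρmem, hρ⟩ : ∃ ρ : ℝ, ρ ∈ (Set.range fun jn : κ × ℤ => ‖p jn.1 * q ^ jn.2‖)ᶜ ∧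
      ρ ∈ Set.Ioi (0 : ℝ) := by
    have hcount : (Set.range fun jn : κ × ℤ => ‖p jn.1 * q ^ jn.2‖).Countable :=
      haveI : Countable κ := Finite.to_countable
      Set.countable_range _
    obtain ⟨ρ, h1, h2⟩ := (hcount.dense_compl ℝ).exists_mem_open isOpen_Ioi Set.nonempty_Ioi
    exact ⟨ρ, h1, h2⟩
  replace hρ : 0 < ρ := hρ
  have hk : ∀ j, ∃ k : ℤ, ρ * ‖q‖ < ‖p j * q ^ k‖ ∧ ‖p j * q ^ k‖ < ρ := by
    intro j
    obtain ⟨n, hn1, hn2⟩ := exists_mem_Ioc_zpow (x := ‖p j‖ / ρ) (y := ‖q‖⁻¹)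
      (div_pos (norm_pos_iff.mpr (hp j)) hρ) ((one_lt_inv₀ hqp).mpr hq1)
    have hne : ‖p j * q ^ (n + 1)‖ ≠ ρ := fun h => hρmem ⟨(j, n + 1), h⟩
    have hqn : 0 < ‖q‖ ^ n := by positivity
    rw [inv_zpow, lt_div_iff₀ hρ, inv_mul_lt_iff₀ hqn] at hn1
    rw [inv_zpow, div_le_iff₀ hρ, zpow_add_one₀ hqp.ne', le_inv_mul_iff₀ (by positivity)] at hn2
    refine ⟨n + 1, ?_, lt_of_le_of_ne ?_ hne⟩
    · rw [norm_mul, norm_zpow, zpow_add_one₀ hqp.ne']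
      nlinarith
    · rw [norm_mul, norm_zpow, zpow_add_one₀ hqp.ne']
      linarith
  choose k hk using hk
  have e : ∀ j (n : ℤ), p j * q ^ k j * q ^ n = p j * q ^ (n + k j) := fun j n => by
    rw [zpow_add₀ hq0]; ring
  have key := sum_tsum_residues_eq_zero_of_mem_annulus (φ := φ) (p := fun j => p j * q ^ k j)
    (w := fun j n => w j (n + k j)) hq0 hq1 hρ hk
    (fun i j hij => by
      by_contra hne
      refine hpp i j hne (k j - k i) ?_
      simp only at hij
      rw [zpow_sub₀ hq0, mul_div_assoc', eq_div_iff (zpow_ne_zero _ hq0), hij])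
    (fun x hx h => hdiff x hx fun j n hn => h j (n - k j) (by rw [e]; simpa using hn))
    (fun j n => by simpa only [e] using hlim j (n + k j))
    (fun j => (Equiv.addRight (k j)).summable_iff.mpr (hsum j)) hzero hinf
  rw [← key]
  exact Finset.sum_congr rfl fun j _ => ((Equiv.addRight (k j)).tsum_eq (w j)).symm

end

/-! ### First-order recurrences for shifted factorials -/

section QPoch

variable {q : ℂ}

theorem qPoch_add_one (hq0 : q ≠ 0) {x : ℂ} (hx : ∀ n : ℕ, x ≠ q ^ (n + 1)) (k : ℤ) :
    qPoch x q (k + 1) = qPoch x q k * (1 - x * q ^ k) := by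
  have hx' : ∀ n : ℕ, 1 - x * q ^ (-((n : ℤ) + 1)) ≠ 0 := fun n h => by
    refine hx n ?_
    rw [sub_eq_zero, zpow_neg, eq_comm, mul_inv_eq_one₀ (zpow_ne_zero _ hq0)] at h
    exact_mod_cast h
  match k with
  | Int.ofNat n =>
    change ∏ j ∈ Finset.range (n + 1), (1 - x * q ^ j) = _
    rw [Finset.prod_range_succ]
    simp [qPoch]
  | Int.negSucc 0 =>
    have := hx' 0
    simp only [Int.reduceNegSucc, Int.reduceNeg, Int.reduceAdd]
    change ∏ j ∈ Finset.range 0, (1 - x * q ^ j) =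
      (∏ j ∈ Finset.range 1, (1 - x * q ^ (-((j : ℤ) + 1))))⁻¹ * _
    simp only [Finset.range_zero, Finset.prod_empty, Finset.prod_range_one]
    norm_num at this ⊢
    rw [inv_mul_cancel₀ this]
  | Int.negSucc (n + 1) =>
    have := hx' (n + 1)
    rw [show Int.negSucc (n + 1) + 1 = Int.negSucc n by omega]
    simp only [qPoch]
    rw [Finset.prod_range_succ _ (n + 1), mul_inv,
      show Int.negSucc (n + 1) = -(((n + 1 : ℕ) : ℤ) + 1) by omega, inv_mul_cancel_right₀ this]

/-- For lower parameters the factor `1 - x q^k` may vanish when `k < 0`, so the recurrence is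
written for inverses and without division; for `k ≥ 0` the hypothesis lets the factor cancel. -/
theorem inv_qPoch_add_one_mul {x : ℂ} (hx : ∀ n : ℕ, x * q ^ n ≠ 1) (k : ℤ) :
    (qPoch x q (k + 1))⁻¹ * (1 - x * q ^ k) = (qPoch x q k)⁻¹ := by
  match k with
  | Int.ofNat n =>
    have : 1 - x * q ^ n ≠ 0 := sub_ne_zero.mpr (hx n).symm
    change (∏ j ∈ Finset.range (n + 1), (1 - x * q ^ j))⁻¹ * _ = _
    rw [Finset.prod_range_succ, mul_inv]
    simp only [Int.ofNat_eq_natCast, zpow_natCast]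
    rw [inv_mul_cancel_right₀ this]
    rfl
  | Int.negSucc 0 =>
    simp only [Int.reduceNegSucc, Int.reduceNeg, Int.reduceAdd]
    change (∏ j ∈ Finset.range 0, (1 - x * q ^ j))⁻¹ * _ =
      (∏ j ∈ Finset.range 1, (1 - x * q ^ (-((j : ℤ) + 1))))⁻¹⁻¹
    simp
  | Int.negSucc (n + 1) =>
    rw [show Int.negSucc (n + 1) + 1 = Int.negSucc n by omega]
    simp only [qPoch, inv_inv]
    rw [Finset.prod_range_succ _ (n + 1),
      show Int.negSucc (n + 1) = -(((n + 1 : ℕ) : ℤ) + 1) by omega]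

end QPoch

/-! ### Recurrence, termination and convergence of bilateral series -/

section PsiTerm

variable {ι : Type*} [Fintype ι] {q : ℂ} {A B : ι → ℂ} {z : ℂ}

@[simp]
theorem psiTerm_zero : psiTerm q A B z 0 = 1 := by
  have : ∀ x : ℂ, qPoch x q 0 = 1 := fun x => by
    change ∏ j ∈ Finset.range 0, (1 - x * q ^ j) = 1
    simp
  simp [psiTerm, this]

/-- Division-free because either product can vanish, which is how a series terminates. Everything
used about the terms follows from this recurrence and the value `1` at `k = 0`. -/
theorem psiTerm_add_one_mul (hq0 : q ≠ 0) (hz : z ≠ 0) (hw : PsiWellDefined q A B) (k : ℤ) :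
    psiTerm q A B z (k + 1) * ∏ i, (1 - B i * q ^ k) =
      z * (∏ i, (1 - A i * q ^ k)) * psiTerm q A B z k := by
  simp only [psiTerm, div_eq_mul_inv, ← Finset.prod_inv_distrib]
  rw [Finset.prod_congr rfl fun i _ => qPoch_add_one hq0 (hw.1 i) k, Finset.prod_mul_distrib,
    ← Finset.prod_congr rfl fun i _ => inv_qPoch_add_one_mul (hw.2 i) k, Finset.prod_mul_distrib,
    zpow_add_one₀ hz]
  ring

theorem PsiWellDefined.prod_lower_ne_zero (hw : PsiWellDefined q A B) (n : ℕ) :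
    ∏ i, (1 - B i * q ^ (n : ℤ)) ≠ 0 :=
  Finset.prod_ne_zero_iff.mpr fun i _ => sub_ne_zero.mpr (by simpa using (hw.2 i n).symm)

theorem PsiWellDefined.prod_upper_ne_zero (hq0 : q ≠ 0) (hw : PsiWellDefined q A B) (n : ℕ) :
    ∏ i, (1 - A i * q ^ (-(n : ℤ) - 1)) ≠ 0 :=
  Finset.prod_ne_zero_iff.mpr fun i _ => sub_ne_zero.mpr fun h => hw.1 i n <| by
    rw [show -(n : ℤ) - 1 = -(((n + 1 : ℕ)) : ℤ) by push_cast; ring, zpow_neg, eq_comm,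
      mul_inv_eq_one₀ (zpow_ne_zero _ hq0)] at h
    exact_mod_cast h

/-- A property of integers holds everywhere if it holds at `0` and propagates as the recurrence of
`psiTerm` allows. -/
theorem PsiWellDefined.induction (hq0 : q ≠ 0) (hw : PsiWellDefined q A B) {P : ℤ → Prop}
    (h0 : P 0) (hup : ∀ k, ∏ i, (1 - B i * q ^ k) ≠ 0 → P k → P (k + 1))
    (hdown : ∀ k, ∏ i, (1 - A i * q ^ k) ≠ 0 → P (k + 1) → P k) (k : ℤ) : P k := by
  induction k using Int.induction_on with
  | zero => exact h0
  | succ n ih => exact hup n (hw.prod_lower_ne_zero n) ih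
  | pred n ih => exact hdown _ (hw.prod_upper_ne_zero hq0 n) (by simpa using ih)

/-- Well-definedness lets the recurrence be solved upwards from `0` and downwards from `0`, so its
solutions form a line even when some terms vanish. -/
theorem eq_mul_psiTerm_of_recurrence (hq0 : q ≠ 0) (hz : z ≠ 0) (hw : PsiWellDefined q A B)
    {u : ℤ → ℂ} (hu : ∀ k, u (k + 1) * ∏ i, (1 - B i * q ^ k) =
      z * (∏ i, (1 - A i * q ^ k)) * u k) (k : ℤ) : u k = u 0 * psiTerm q A B z k := by
  refine hw.induction hq0 (P := fun k => u k = u 0 * psiTerm q A B z k) (by simp)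
    (fun k hD ih => ?_) (fun k hN ih => ?_) k
  · refine mul_right_cancel₀ hD ?_
    rw [hu, ih, mul_assoc (u 0), psiTerm_add_one_mul hq0 hz hw]
    ring
  · refine mul_left_cancel₀ (mul_ne_zero hz hN) ?_
    rw [← hu, ih, mul_assoc (u 0), psiTerm_add_one_mul hq0 hz hw]
    ring

/-- Starting from the term `1` at index `0`, a term of positive index can vanish only through a
vanishing upper factor. -/
theorem exists_upper_of_terminatesAbove (hq0 : q ≠ 0) (hz : z ≠ 0) (hw : PsiWellDefined q A B)
    (ht : TerminatesAbove (psiTerm q A B z)) : ∃ i, ∃ n : ℕ, A i * q ^ n = 1 := by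
  by_contra! hA
  have hne : ∀ n : ℕ, psiTerm q A B z n ≠ 0 := by
    intro n
    induction n with
    | zero => simp
    | succ n ih =>
      intro h
      have h1 := psiTerm_add_one_mul hq0 hz hw n
      rw [← Nat.cast_succ, h, zero_mul] at h1
      refine mul_ne_zero (mul_ne_zero hz ?_) ih h1.symm
      exact Finset.prod_ne_zero_iff.mpr fun i _ =>
        sub_ne_zero.mpr (by simpa using (hA i n).symm)
  obtain ⟨N, hN⟩ := ht
  exact hne (N.toNat + 1) (hN _ (by push_cast; omega))

theorem exists_lower_of_terminatesBelow (hq0 : q ≠ 0) (hz : z ≠ 0) (hw : PsiWellDefined q A B)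
    (ht : TerminatesBelow (psiTerm q A B z)) : ∃ i, ∃ n : ℕ, B i = q ^ (n + 1) := by
  by_contra! hB
  have hne : ∀ n : ℕ, psiTerm q A B z (-(n : ℤ)) ≠ 0 := by
    intro n
    induction n with
    | zero => simp
    | succ n ih =>
      intro h
      have h1 := psiTerm_add_one_mul hq0 hz hw (-((n + 1 : ℕ) : ℤ))
      rw [h, mul_zero, show -((n + 1 : ℕ) : ℤ) + 1 = -(n : ℤ) by push_cast; ring] at h1
      refine mul_ne_zero ih ?_ h1
      refine Finset.prod_ne_zero_iff.mpr fun i _ => sub_ne_zero.mpr fun h2 => hB i n ?_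
      rw [zpow_neg, eq_comm, mul_inv_eq_one₀ (zpow_ne_zero _ hq0)] at h2
      exact_mod_cast h2
  obtain ⟨N, hN⟩ := ht
  exact hne ((-N).toNat + 1) (hN _ (by push_cast; omega))

/-- The ratio tends to `z` as `x → 0`. Arbitrary `u`, `v` allow two uses: consecutive terms of a
series, and the kernel at `x` and `q x`. -/
theorem exists_contraction_nhds_zero (hz : ‖z‖ < 1) :
    ∃ c < 1, ∀ᶠ x : ℂ in 𝓝 0, ∀ u v : ℂ,
      v * ∏ i, (1 - B i * x) = z * (∏ i, (1 - A i * x)) * u → ‖v‖ ≤ c * ‖u‖ := by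
  obtain ⟨c, hzc, hc⟩ := exists_between hz
  have hD : ContinuousAt (fun x : ℂ => ∏ i, (1 - B i * x)) 0 := by fun_prop
  have hN : ContinuousAt (fun x : ℂ => ∏ i, (1 - A i * x)) 0 := by fun_prop
  have hf : ContinuousAt (fun x : ℂ => ‖z * (∏ i, (1 - A i * x)) / ∏ i, (1 - B i * x)‖) 0 :=
    ((continuousAt_const.mul hN).div hD (by simp)).norm
  refine ⟨c, hc, ?_⟩
  filter_upwards [hf.eventually (gt_mem_nhds (show _ < c by simpa using hzc)),
    hD.eventually_ne (y := 0) (by simp)] with x hx hx0 u v huv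
  rw [eq_div_of_mul_eq hx0 huv, mul_div_right_comm, norm_mul]
  exact mul_le_mul_of_nonneg_right hx.le (norm_nonneg u)

theorem eventually_one_sub_mul_ne_zero (y : ℂ) :
    ∀ᶠ x : ℂ in Bornology.cobounded ℂ, 1 - y * x ≠ 0 := by
  have h : ({y⁻¹} : Set ℂ)ᶜ ∈ Bornology.cobounded ℂ :=
    Bornology.isBounded_def.mp Bornology.isBounded_singleton
  filter_upwards [h] with x hx h0
  rw [sub_eq_zero] at h0
  exact hx (eq_inv_of_mul_eq_one_right h0.symm)

/-- The counterpart at infinity, where the inverse ratio tends to `l / z`. -/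
theorem exists_contraction_cobounded {l : ℂ} (hl : ‖l‖ < ‖z‖)
    (hlim : Tendsto (fun x => (∏ i, (1 - B i * x)) / ∏ i, (1 - A i * x))
      (Bornology.cobounded ℂ) (𝓝 l)) :
    ∃ c < 1, ∀ᶠ x : ℂ in Bornology.cobounded ℂ, ∀ u v : ℂ,
      v * ∏ i, (1 - B i * x) = z * (∏ i, (1 - A i * x)) * u → ‖u‖ ≤ c * ‖v‖ := by
  have hz : 0 < ‖z‖ := (norm_nonneg l).trans_lt hl
  have hz0 : z ≠ 0 := norm_pos_iff.mp hz
  obtain ⟨c, hlc, hc⟩ := exists_between ((div_lt_one hz).mpr hl)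
  have hf := (hlim.div_const z).norm
  rw [norm_div] at hf
  have hN : ∀ᶠ x : ℂ in Bornology.cobounded ℂ, ∏ i, (1 - A i * x) ≠ 0 := by
    filter_upwards [eventually_all.mpr fun i => eventually_one_sub_mul_ne_zero (A i)] with x hx
    exact Finset.prod_ne_zero_iff.mpr fun i _ => hx i
  refine ⟨c, hc, ?_⟩
  filter_upwards [hf.eventually (gt_mem_nhds hlc), hN] with x hx hx0 u v huv
  have : u = (∏ i, (1 - B i * x)) / (∏ i, (1 - A i * x)) / z * v := by
    rw [div_div, div_mul_eq_mul_div, eq_div_iff (mul_ne_zero hx0 hz0)]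
    linear_combination -huv
  rw [this, norm_mul]
  exact mul_le_mul_of_nonneg_right hx.le (norm_nonneg v)

/-- Absolute convergence of a bilateral series with parameters scaled by `p`. -/
theorem summable_psiTerm (hq0 : q ≠ 0) (hq1 : ‖q‖ < 1) (hz : z ≠ 0) {p : ℂ} (hp : p ≠ 0)
    (hw : PsiWellDefined q (fun i => A i * p) (fun i => B i * p))
    (hup : ‖z‖ < 1 ∨ TerminatesAbove (psiTerm q (fun i => A i * p) (fun i => B i * p) z))
    {l : ℂ} (hlim : Tendsto (fun x => (∏ i, (1 - B i * x)) / ∏ i, (1 - A i * x))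
      (Bornology.cobounded ℂ) (𝓝 l))
    (hlow : ‖l‖ < ‖z‖ ∨ TerminatesBelow (psiTerm q (fun i => A i * p) (fun i => B i * p) z)) :
    Summable (psiTerm q (fun i => A i * p) (fun i => B i * p) z) := by
  have hqp : 0 < ‖q‖ := norm_pos_iff.mpr hq0
  set t := psiTerm q (fun i => A i * p) (fun i => B i * p) z with ht
  have hrec : ∀ k : ℤ, t (k + 1) * ∏ i, (1 - B i * (p * q ^ k)) =
      z * (∏ i, (1 - A i * (p * q ^ k))) * t k := fun k => by
    simpa only [mul_assoc] using psiTerm_add_one_mul hq0 hz hw k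
  refine Summable.of_nat_of_neg_add_one ?_ ?_
  · rcases hup with hz1 | ⟨N, hN⟩
    · obtain ⟨c, hc, h⟩ := exists_contraction_nhds_zero (A := A) (B := B) hz1
      have hlim0 : Tendsto (fun n : ℕ => p * q ^ n) atTop (𝓝 0) := by
        simpa using (tendsto_pow_atTop_nhds_zero_of_norm_lt_one hq1).const_mul p
      refine summable_of_ratio_norm_eventually_le hc ?_
      filter_upwards [hlim0.eventually h] with n hn
      exact hn _ _ (by simpa using hrec n)
    · refine summable_of_ne_finset_zero (s := Finset.range (N.toNat + 1)) fun n hn => hN _ ?_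
      simp at hn
      omega
  · rcases hlow with hl | ⟨N, hN⟩
    · obtain ⟨c, hc, h⟩ := exists_contraction_cobounded hl hlim
      -- The negative half is indexed by `-(n + 1)`, so its entries `n` and `n + 1` are linked by
      -- the recurrence at `k = -(n + 2)`.
      have hlim0 : Tendsto (fun n : ℕ => p * q ^ (-((n : ℤ) + 2))) atTop
          (Bornology.cobounded ℂ) := by
        rw [← tendsto_norm_atTop_iff_cobounded]
        have h1 := (tendsto_pow_atTop_atTop_of_one_lt ((one_lt_inv₀ hqp).mpr hq1)).const_mul_atTop
          (show 0 < ‖p‖ * (‖q‖ ^ 2)⁻¹ from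
            mul_pos (norm_pos_iff.mpr hp) (by positivity))
        refine h1.congr fun n => ?_
        rw [norm_mul, norm_zpow, zpow_neg, zpow_add₀ hqp.ne', mul_inv, zpow_natCast, inv_pow]
        norm_cast
        ring
      refine summable_of_ratio_norm_eventually_le hc ?_
      filter_upwards [hlim0.eventually h] with n hn
      refine hn _ _ ?_
      have := hrec (-((n : ℤ) + 2))
      rw [show -((n : ℤ) + 2) + 1 = -((n : ℤ) + 1) by ring] at this
      rw [this, show -(((n + 1 : ℕ) : ℤ) + 1) = -((n : ℤ) + 2) by push_cast; ring]
    · refine summable_of_ne_finset_zero (s := Finset.range ((-N).toNat + 1)) fun n hn => hN _ ?_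
      simp at hn
      omega

end PsiTerm

/-! ### Infinite products and the theta function -/

section QInf

variable {q : ℂ}

theorem differentiable_qInf (hq1 : ‖q‖ < 1) : Differentiable ℂ fun x => qInf x q := by
  intro x
  have hs : Summable fun n : ℕ => (‖x‖ + 1) * ‖q‖ ^ n :=
    (summable_geometric_of_lt_one (norm_nonneg q) hq1).mul_left _
  have key := hs.hasProdLocallyUniformlyOn_nat_one_add (f := fun (n : ℕ) (y : ℂ) => -(y * q ^ n))
    (Metric.isOpen_ball (x := (0 : ℂ)) (ε := ‖x‖ + 1))
    (.of_forall fun n y hy => by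
      rw [norm_neg, norm_mul, norm_pow]
      have : ‖y‖ < ‖x‖ + 1 := by simpa using hy
      gcongr)
    (fun n => by fun_prop)
  have hd := (hasProdLocallyUniformlyOn_iff_tendstoLocallyUniformlyOn.mp key).differentiableOn
    (.of_forall fun s => by fun_prop) Metric.isOpen_ball
  have := hd.differentiableAt (x := x) (Metric.isOpen_ball.mem_nhds (by simp))
  simpa only [qInf, sub_eq_add_neg] using this

theorem qInf_eq_one_sub_mul (hq1 : ‖q‖ < 1) (x : ℂ) :
    qInf x q = (1 - x) * qInf (q * x) q := by
  simpa [mul_comm q] using qInf_eq_prod_mul x hq1 1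

theorem qInf_ne_zero (hq1 : ‖q‖ < 1) {x : ℂ} (hx : ∀ n : ℕ, x * q ^ n ≠ 1) : qInf x q ≠ 0 := by
  have h := tprod_one_add_ne_zero_of_summable (f := fun n : ℕ => -(x * q ^ n))
    (fun n h => hx n (by linear_combination -h)) (by
      simpa [norm_mul, norm_pow] using
        (summable_geometric_of_lt_one (norm_nonneg q) hq1).mul_left ‖x‖)
  simpa only [qInf, sub_eq_add_neg] using h

theorem qInf_eq_zero (hq1 : ‖q‖ < 1) {x : ℂ} {n : ℕ} (hx : x * q ^ n = 1) : qInf x q = 0 := by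
  rw [qInf_eq_prod_mul x hq1 (n + 1), Finset.prod_range_succ, hx]
  simp

theorem qPoch_natCast (x q : ℂ) (n : ℕ) :
    qPoch x q n = ∏ j ∈ Finset.range n, (1 - x * q ^ j) := rfl

theorem qPoch_mul_one_sub (x q : ℂ) (n : ℕ) :
    qPoch (x * q) q n * (1 - x) = qPoch x q n * (1 - x * q ^ n) := by
  rw [qPoch_natCast, qPoch_natCast, ← Finset.prod_range_succ, Finset.prod_range_succ']
  simp [pow_succ', mul_assoc]

/-- The modified Jacobi theta function `(x, q/x; q)_∞`. -/
noncomputable def theta (q x : ℂ) : ℂ := qInf x q * qInf (q / x) q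

theorem theta_q_div (hq0 : q ≠ 0) (x : ℂ) : theta q (q / x) = theta q x := by
  rw [theta, theta, div_div_cancel₀ hq0, mul_comm]

theorem theta_q_mul (hq0 : q ≠ 0) (hq1 : ‖q‖ < 1) {x : ℂ} (hx : x ≠ 0) :
    theta q (q * x) = -x⁻¹ * theta q x := by
  have : q / (q * x) = x⁻¹ := by field_simp
  rw [theta, theta, qInf_eq_one_sub_mul hq1 x, this, qInf_eq_one_sub_mul hq1 x⁻¹,
    ← div_eq_mul_inv]
  linear_combination -qInf (q * x) q * qInf (q / x) q * inv_mul_cancel₀ hx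

theorem theta_ne_zero (hq0 : q ≠ 0) (hq1 : ‖q‖ < 1) {x : ℂ} (hx : ∀ n : ℤ, x ≠ q ^ n) :
    theta q x ≠ 0 := by
  -- At `x = 0` the convention `q / 0 = 0` gives `theta q 0 = 1`.
  by_cases hx0 : x = 0
  · simp [hx0, theta, qInf]
  refine mul_ne_zero (qInf_ne_zero hq1 fun n h => ?_) (qInf_ne_zero hq1 fun n h => ?_)
  · exact hx (-n) (by rw [zpow_neg, zpow_natCast]; exact eq_inv_of_mul_eq_one_left h)
  · refine hx (n + 1) ?_
    rw [zpow_add_one₀ hq0, zpow_natCast]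
    field_simp at h
    rw [← h]
    ring

theorem theta_zpow (hq0 : q ≠ 0) (hq1 : ‖q‖ < 1) (n : ℤ) : theta q (q ^ n) = 0 := by
  rcases le_or_gt n 0 with hn | hn
  · obtain ⟨k, rfl⟩ := Int.exists_eq_neg_ofNat hn
    rw [theta, qInf_eq_zero hq1 (n := k), zero_mul]
    rw [zpow_neg, zpow_natCast, inv_mul_cancel₀ (pow_ne_zero k hq0)]
  · obtain ⟨k, rfl⟩ := Int.eq_succ_of_zero_lt hn
    rw [theta, qInf_eq_zero (x := q / _) hq1 (n := k), mul_zero]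
    have : q ^ ((k : ℤ) + 1) = q * q ^ k := by rw [zpow_add_one₀ hq0, zpow_natCast, mul_comm]
    rw [this]
    field_simp

theorem differentiableAt_theta (hq1 : ‖q‖ < 1) {f : ℂ → ℂ} {x : ℂ} (hf : DifferentiableAt ℂ f x)
    (hx : f x ≠ 0) : DifferentiableAt ℂ (fun x => theta q (f x)) x :=
  ((differentiable_qInf hq1).differentiableAt.comp (g := fun x => qInf x q) x hf).mul
    ((differentiable_qInf hq1).differentiableAt.comp (g := fun x => qInf x q) x
      ((differentiableAt_const q).div hf hx))

/-- The residue of `1 / θ` at `1`. -/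
theorem tendsto_one_sub_mul_inv_theta (hq1 : ‖q‖ < 1) :
    Tendsto (fun x => (1 - x) * (theta q x)⁻¹) (𝓝[≠] 1) (𝓝 (qInf q q ^ 2)⁻¹) := by
  have hc : Continuous fun x => qInf x q := (differentiable_qInf hq1).continuous
  have hne : qInf q q ≠ 0 := qInf_ne_zero hq1 fun n h => by
    have h1 : ‖q * q ^ n‖ = 1 := by rw [h, norm_one]
    rw [← pow_succ', norm_pow] at h1
    exact (pow_lt_one₀ (norm_nonneg q) hq1 n.succ_ne_zero).ne h1
  have h1 : ContinuousAt (fun x => (qInf (q * x) q * qInf (q / x) q)⁻¹) 1 := by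
    refine ContinuousAt.inv₀ (ContinuousAt.mul ?_ ?_) (by simp [hne])
    · exact hc.continuousAt.comp (f := fun x => q * x) (by fun_prop)
    · refine hc.continuousAt.comp (f := fun x => q / x) ?_
      exact continuousAt_const.div continuousAt_id one_ne_zero
  have h2 := h1.tendsto.mono_left (nhdsWithin_le_nhds (s := {1}ᶜ))
  simp only [mul_one, div_one, ← sq] at h2
  refine h2.congr' ?_
  filter_upwards [self_mem_nhdsWithin] with x hx
  have : 1 - x ≠ 0 := sub_ne_zero.mpr (Ne.symm hx)
  rw [theta, qInf_eq_one_sub_mul hq1 x, mul_assoc, mul_inv (1 - x), mul_inv_cancel_left₀ this]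

end QInf

/-! ### The kernel and its functional equation -/

section Kernel

variable {r s : ℕ} {q : ℂ} {a b c : Fin r → ℂ} {h : Fin s → ℂ} {m : Fin s → ℕ} {y d z : ℂ}

/-- The holomorphic part of `bilateralKernel`. -/
noncomputable def kernelNumerator (q : ℂ) (a b : Fin r → ℂ) (h : Fin s → ℂ) (m : Fin s → ℕ) (x : ℂ) : ℂ :=
  (∏ i, qInf (b i * x) q) * (∏ i, qInf (q / (a i * x)) q) * ∏ i, qPoch (h i * x) q (m i)

/-- A function whose values at `p q^n` are proportional to the terms of a bilateral series. -/
noncomputable def bilateralKernel (q : ℂ) (a b : Fin r → ℂ) (h : Fin s → ℂ) (m : Fin s → ℕ) (y d : ℂ)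
    (c : Fin r → ℂ) (x : ℂ) : ℂ :=
  kernelNumerator q a b h m x * theta q (x / y) * (theta q (d * x) * ∏ i, theta q (c i * x))⁻¹

/-- Replacing `x` by `q x` removes `1 - b_i x` from one product, adds `1 - (a_i x)⁻¹ = -(a_i x)⁻¹ (1
- a_i x)` to another, and telescopes the finite ones. The monomials `-(a_i x)⁻¹` are left for the
theta factors to cancel. -/
theorem kernelNumerator_q_mul (hq0 : q ≠ 0) (hq1 : ‖q‖ < 1) (ha : ∀ i, a i ≠ 0) {x : ℂ}
    (hx : x ≠ 0) :
    kernelNumerator q a b h m (q * x) * ∏ i, (1 - kmLower b h i * x) =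
      kernelNumerator q a b h m x * (∏ i, -(a i * x)⁻¹) * ∏ i, (1 - kmUpper q a h m i * x) := by
  simp only [kernelNumerator, kmLower, kmUpper, Fintype.prod_sum_type, Sum.elim_inl, Sum.elim_inr]
  have h1 : ∏ i, qInf (b i * x) q = (∏ i, (1 - b i * x)) * ∏ i, qInf (b i * (q * x)) q := by
    rw [← Finset.prod_mul_distrib]
    refine Finset.prod_congr rfl fun i _ => ?_
    rw [qInf_eq_one_sub_mul hq1, mul_left_comm]
  have h2 : ∏ i, qInf (q / (a i * (q * x))) q =
      (∏ i, -(a i * x)⁻¹) * (∏ i, (1 - a i * x)) * ∏ i, qInf (q / (a i * x)) q := by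
    rw [← Finset.prod_mul_distrib, ← Finset.prod_mul_distrib]
    refine Finset.prod_congr rfl fun i _ => ?_
    have := ha i
    have e1 : q / (a i * (q * x)) = (a i * x)⁻¹ := by field_simp
    rw [qInf_eq_one_sub_mul hq1, e1, ← div_eq_mul_inv]
    congr 1
    field_simp
    ring
  have h3 : (∏ i, qPoch (h i * (q * x)) q (m i)) * ∏ i, (1 - h i * x) =
      (∏ i, qPoch (h i * x) q (m i)) * ∏ i, (1 - h i * q ^ m i * x) := by
    rw [← Finset.prod_mul_distrib, ← Finset.prod_mul_distrib]
    refine Finset.prod_congr rfl fun i _ => ?_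
    rw [show h i * (q * x) = h i * x * q by ring, qPoch_mul_one_sub,
      show h i * q ^ m i * x = h i * x * q ^ m i by ring]
  rw [h1, h2]
  linear_combination (∏ i, qInf (b i * (q * x)) q) * (∏ i, -(a i * x)⁻¹) *
    (∏ i, (1 - a i * x)) * (∏ i, qInf (q / (a i * x)) q) * (∏ i, (1 - b i * x)) * h3

/-- The theta quotient has one theta above and `r + 1` below, so with the `r` monomials of the
numerator all powers of `x` and signs cancel; `hz` says that the remaining constant is `z`. The main
kernel has `d = 1`; a general `d` serves the case of colliding poles. -/
theorem bilateralKernel_q_mul (hq0 : q ≠ 0) (hq1 : ‖q‖ < 1) (ha : ∀ i, a i ≠ 0)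
    (hc : ∀ i, c i ≠ 0) (hd : d ≠ 0) (hy : y ≠ 0) (hz : y * d * ∏ i, c i = z * ∏ i, a i) {x : ℂ}
    (hx : x ≠ 0) :
    bilateralKernel q a b h m y d c (q * x) * ∏ i, (1 - kmLower b h i * x) =
      z * (∏ i, (1 - kmUpper q a h m i * x)) * bilateralKernel q a b h m y d c x := by
  have h1 := kernelNumerator_q_mul (b := b) (h := h) (m := m) hq0 hq1 ha hx
  have h2 : theta q (q * x / y) = -(x / y)⁻¹ * theta q (x / y) := by
    rw [mul_div_assoc, theta_q_mul hq0 hq1 (div_ne_zero hx hy)]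
  have h3 : theta q (d * (q * x)) = -(d * x)⁻¹ * theta q (d * x) := by
    rw [mul_left_comm, theta_q_mul hq0 hq1 (mul_ne_zero hd hx)]
  have h4 : ∏ i, theta q (c i * (q * x)) = (∏ i, -(c i * x)⁻¹) * ∏ i, theta q (c i * x) := by
    rw [← Finset.prod_mul_distrib]
    refine Finset.prod_congr rfl fun i _ => ?_
    rw [mul_left_comm, theta_q_mul hq0 hq1 (mul_ne_zero (hc i) hx)]
  have ha' : ∏ i, a i ≠ 0 := Finset.prod_ne_zero_iff.mpr fun i _ => ha i
  have h5 : (∏ i, -(a i * x)⁻¹) * (x / y)⁻¹ = z * (d * x)⁻¹ * ∏ i, -(c i * x)⁻¹ := by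
    have hc' : ∏ i, c i ≠ 0 := Finset.prod_ne_zero_iff.mpr fun i _ => hc i
    have e : ∀ f : Fin r → ℂ, ∏ i, -(f i * x)⁻¹ = (∏ i, f i)⁻¹ * ∏ _i : Fin r, -x⁻¹ := fun f => by
      rw [← Finset.prod_inv_distrib, ← Finset.prod_mul_distrib]
      exact Finset.prod_congr rfl fun i _ => by rw [mul_inv]; ring
    rw [e, e]
    generalize ∏ _i : Fin r, -x⁻¹ = X
    field_simp
    linear_combination X * hz
  have h6 : (-(d * x)⁻¹ * ∏ i, -(c i * x)⁻¹) ≠ 0 :=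
    mul_ne_zero (neg_ne_zero.mpr (inv_ne_zero (mul_ne_zero hd hx)))
      (Finset.prod_ne_zero_iff.mpr fun i _ =>
        neg_ne_zero.mpr (inv_ne_zero (mul_ne_zero (hc i) hx)))
  simp only [bilateralKernel]
  rw [h2, h3, h4, show -(d * x)⁻¹ * theta q (d * x) *
      ((∏ i, -(c i * x)⁻¹) * ∏ i, theta q (c i * x)) =
      (-(d * x)⁻¹ * ∏ i, -(c i * x)⁻¹) * (theta q (d * x) * ∏ i, theta q (c i * x)) by ring,
    mul_inv (-(d * x)⁻¹ * ∏ i, -(c i * x)⁻¹)]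
  generalize (theta q (d * x) * ∏ i, theta q (c i * x))⁻¹ = T
  have h7 : -(∏ i, -(a i * x)⁻¹) * (x / y)⁻¹ * (-(d * x)⁻¹ * ∏ i, -(c i * x)⁻¹)⁻¹ = z := by
    rw [← div_eq_mul_inv, div_eq_iff h6]
    linear_combination -h5
  rw [← h7]
  linear_combination -(x / y)⁻¹ * theta q (x / y) *
    (-(d * x)⁻¹ * ∏ i, -(c i * x)⁻¹)⁻¹ * T * h1

theorem differentiableAt_kernelNumerator (hq1 : ‖q‖ < 1) (ha : ∀ i, a i ≠ 0) {x : ℂ}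
    (hx : x ≠ 0) : DifferentiableAt ℂ (kernelNumerator q a b h m) x := by
  have hd := differentiable_qInf hq1
  refine ((DifferentiableAt.fun_finsetProd fun i _ => ?_).mul
    (DifferentiableAt.fun_finsetProd fun i _ => ?_)).mul
    (DifferentiableAt.fun_finsetProd fun i _ => ?_)
  · exact hd.differentiableAt.comp (g := fun x => qInf x q) x (by fun_prop)
  · exact hd.differentiableAt.comp (g := fun x => qInf x q) x
      ((differentiableAt_const q).div (by fun_prop) (mul_ne_zero (ha i) hx))
  · simp only [qPoch_natCast]
    fun_prop

end Kernel

/-! ### Residues along a family of poles, and the term ratio at infinity -/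

/-- A limit of `(1 - x / (p q^n)) φ x` at `n = 0` determines the limits for all `n` if `φ` satisfies
the recurrence of a bilateral series. -/
theorem tendsto_one_sub_div_mul_of_recurrence {ι : Type*} [Fintype ι] {q z p w : ℂ} {A B : ι → ℂ}
    {φ : ℂ → ℂ} (hq0 : q ≠ 0) (hz : z ≠ 0) (hp : p ≠ 0)
    (hw : PsiWellDefined q (fun i => A i * p) (fun i => B i * p))
    (hφ : ∀ x, x ≠ 0 → φ (q * x) * ∏ i, (1 - B i * x) = z * (∏ i, (1 - A i * x)) * φ x)
    (h0 : Tendsto (fun x => (1 - x / p) * φ x) (𝓝[≠] p) (𝓝 w)) (n : ℤ) :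
    Tendsto (fun x => (1 - x / (p * q ^ n)) * φ x) (𝓝[≠] (p * q ^ n))
      (𝓝 (w * psiTerm q (fun i => A i * p) (fun i => B i * p) z n)) := by
  set t := psiTerm q (fun i => A i * p) (fun i => B i * p) z with ht
  have hrec : ∀ k : ℤ, t (k + 1) * ∏ i, (1 - B i * (p * q ^ k)) =
      z * (∏ i, (1 - A i * (p * q ^ k))) * t k := fun k => by
    simpa only [mul_assoc] using psiTerm_add_one_mul hq0 hz hw k
  have hc : ∀ (C : ι → ℂ) (x : ℂ), ContinuousAt (fun x => ∏ i, (1 - C i * x)) x :=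
    fun C x => by fun_prop
  have hmap : ∀ {k : ℂ}, k ≠ 0 → ∀ y : ℂ,
      Tendsto (fun x => k * x) (𝓝[≠] y) (𝓝[≠] (k * y)) := fun {k} hk y => by
    refine tendsto_nhdsWithin_of_tendsto_nhds_of_eventually_within _
      ((continuous_const.mul continuous_id).continuousAt.tendsto.mono_left nhdsWithin_le_nhds) ?_
    filter_upwards [self_mem_nhdsWithin] with x hx hxy
    exact hx (mul_left_cancel₀ hk hxy)
  -- The ratio `φ (q x) / φ x` is continuous at `p q^k` going up and its inverse is continuous there
  -- going down, exactly where the induction principle supplies a nonzero product; the limits are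
  -- then carried over by `x ↦ q⁻¹ x` and `x ↦ q x`.
  refine hw.induction hq0 (P := fun n => Tendsto (fun x => (1 - x / (p * q ^ n)) * φ x)
    (𝓝[≠] (p * q ^ n)) (𝓝 (w * t n))) (by simpa [ht] using h0) (fun k hD ih => ?_)
    (fun k hN ih => ?_) n
  · simp only [mul_assoc] at hD
    have hP : p * q ^ k ≠ 0 := mul_ne_zero hp (zpow_ne_zero k hq0)
    have hq : p * q ^ (k + 1) = q * (p * q ^ k) := by rw [zpow_add_one₀ hq0]; ring
    have e : w * t (k + 1) = w * t k * (z * (∏ i, (1 - A i * (p * q ^ k))) /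
        ∏ i, (1 - B i * (p * q ^ k))) := by
      rw [mul_div_assoc', eq_div_iff hD]
      linear_combination w * hrec k
    have h1 : Tendsto (fun x => (1 - x / (p * q ^ k)) * φ x *
        (z * (∏ i, (1 - A i * x)) / ∏ i, (1 - B i * x))) (𝓝[≠] (p * q ^ k))
        (𝓝 (w * t (k + 1))) := by
      rw [e]
      exact ih.mul ((((hc A _).const_mul z).div (hc B _) hD).tendsto.mono_left nhdsWithin_le_nhds)
    have h2 : Tendsto (fun x => (1 - q * x / (p * q ^ (k + 1))) * φ (q * x)) (𝓝[≠] (p * q ^ k))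
        (𝓝 (w * t (k + 1))) := by
      refine h1.congr' ?_
      filter_upwards [((hc B _).eventually_ne hD).filter_mono nhdsWithin_le_nhds,
        (isOpen_ne.eventually_mem hP).filter_mono nhdsWithin_le_nhds] with x hx hx0
      rw [eq_div_of_mul_eq hx (hφ x hx0), hq, mul_div_mul_left _ _ hq0]
      ring
    have h3 := h2.comp (hmap (inv_ne_zero hq0) (p * q ^ (k + 1)) |>.mono_right (by
      rw [hq, inv_mul_cancel_left₀ hq0]))
    refine h3.congr fun x => ?_
    simp only [Function.comp_apply, mul_inv_cancel_left₀ hq0]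
  · simp only [mul_assoc] at hN
    have hP : p * q ^ k ≠ 0 := mul_ne_zero hp (zpow_ne_zero k hq0)
    have hq : p * q ^ (k + 1) = q * (p * q ^ k) := by rw [zpow_add_one₀ hq0]; ring
    have hN' := mul_ne_zero hz hN
    have e : w * t k = w * t (k + 1) * ((∏ i, (1 - B i * (p * q ^ k))) /
        (z * ∏ i, (1 - A i * (p * q ^ k)))) := by
      rw [mul_div_assoc', eq_div_iff hN']
      linear_combination -w * hrec k
    have h1 := ih.comp ((hmap hq0 (p * q ^ k)).mono_right (by rw [hq]))
    rw [e]
    refine (h1.mul (((hc B _).div ((hc A _).const_mul z) hN').tendsto.mono_left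
      nhdsWithin_le_nhds)).congr' ?_
    filter_upwards [(((hc A _).const_mul z).eventually_ne hN').filter_mono nhdsWithin_le_nhds,
      (isOpen_ne.eventually_mem hP).filter_mono nhdsWithin_le_nhds] with x hx hx0
    simp only [Function.comp_apply, Pi.div_apply]
    rw [hq, mul_div_mul_left _ _ hq0, mul_div_assoc', div_eq_iff hx]
    linear_combination (1 - x / (p * q ^ k)) * hφ x hx0

theorem tendsto_one_sub_div_one_sub {A B : ℂ} (hA : A ≠ 0) :
    Tendsto (fun x => (1 - B * x) / (1 - A * x)) (Bornology.cobounded ℂ) (𝓝 (B / A)) := by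
  have h1 : Tendsto (fun x : ℂ => (x⁻¹ - B) / (x⁻¹ - A)) (Bornology.cobounded ℂ)
      (𝓝 ((0 - B) / (0 - A))) :=
    (tendsto_inv₀_cobounded.sub_const B).div (tendsto_inv₀_cobounded.sub_const A) (by simpa)
  rw [zero_sub, zero_sub, neg_div_neg_eq] at h1
  refine h1.congr' ?_
  filter_upwards [(Bornology.isBounded_def.mp Bornology.isBounded_singleton :
    ({0} : Set ℂ)ᶜ ∈ Bornology.cobounded ℂ)] with x hx
  have hx : x ≠ 0 := hx
  rw [← mul_div_mul_right _ _ hx, sub_mul, sub_mul, inv_mul_cancel₀ hx]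

/-- A factor with `h i = 0` is constantly `1` instead of tending to `q ^ (-m i)`. Since `‖q‖ < 1`
this only lowers the norm of the limit, hence an inequality. -/
theorem exists_tendsto_lower_div_upper {r s : ℕ} {q : ℂ} {a b : Fin r → ℂ} {h : Fin s → ℂ}
    {m : Fin s → ℕ} (hq0 : q ≠ 0) (hq1 : ‖q‖ < 1) (ha : ∀ i, a i ≠ 0) :
    ∃ l : ℂ, ‖l‖ ≤ ‖(∏ i, b i) * q ^ (-((∑ i, m i : ℕ) : ℤ)) / ∏ i, a i‖ ∧
      Tendsto (fun x => (∏ i, (1 - kmLower b h i * x)) / ∏ i, (1 - kmUpper q a h m i * x))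
        (Bornology.cobounded ℂ) (𝓝 l) := by
  refine ⟨(∏ i, b i / a i) * ∏ i, if h i = 0 then 1 else (q ^ m i)⁻¹, ?_, ?_⟩
  · have h1 : q ^ (-((∑ i, m i : ℕ) : ℤ)) = ∏ i, (q ^ m i)⁻¹ := by
      rw [zpow_neg, zpow_natCast, Finset.prod_inv_distrib, Finset.prod_pow_eq_pow_sum]
    rw [h1, mul_div_right_comm, ← Finset.prod_div_distrib, norm_mul, norm_mul]
    refine mul_le_mul_of_nonneg_left ?_ (norm_nonneg _)
    rw [norm_prod, norm_prod]
    refine Finset.prod_le_prod (fun _ _ => norm_nonneg _) fun i _ => ?_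
    split_ifs
    · rw [norm_one, norm_inv, norm_pow]
      exact (one_le_inv₀ (pow_pos (norm_pos_iff.mpr hq0) _)).mpr
        (pow_le_one₀ (norm_nonneg q) hq1.le)
    · exact le_rfl
  · simp only [Fintype.prod_sum_type, kmLower, kmUpper, Sum.elim_inl, Sum.elim_inr,
      mul_div_mul_comm]
    simp only [← Finset.prod_div_distrib]
    refine (tendsto_finsetProd _ fun i _ => tendsto_one_sub_div_one_sub (ha i)).mul
      (tendsto_finsetProd _ fun i _ => ?_)
    split_ifs with h0
    · simp [h0]
    · have := tendsto_one_sub_div_one_sub (A := h i * q ^ m i) (B := h i)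
        (mul_ne_zero h0 (pow_ne_zero _ hq0))
      rwa [div_mul_cancel_left₀ h0] at this

/-! ### The transformation formula with theta coefficients -/

section Slater

variable {r s : ℕ} {q : ℂ} {a b c : Fin r → ℂ} {h : Fin s → ℂ} {m : Fin s → ℕ} {y z : ℂ}

/-- The terms of the series with parameters `kmUpper`, `kmLower` scaled by `p`. -/
noncomputable def scaledTerm (q : ℂ) (a b : Fin r → ℂ) (h : Fin s → ℂ) (m : Fin s → ℕ) (z p : ℂ) :
    ℤ → ℂ :=
  psiTerm q (fun i => kmUpper q a h m i * p) (fun i => kmLower b h i * p) z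

/-- The series with parameters `kmUpper`, `kmLower` scaled by `p` is well-defined. -/
def ScaledWellDefined (q : ℂ) (a b : Fin r → ℂ) (h : Fin s → ℂ) (m : Fin s → ℕ) (p : ℂ) : Prop :=
  PsiWellDefined q (fun i => kmUpper q a h m i * p) (fun i => kmLower b h i * p)

/-- The coefficient of the `j`-th series in the transformation formula, in terms of theta
functions. -/
noncomputable def slaterCoeff (q : ℂ) (a b : Fin r → ℂ) (h : Fin s → ℂ) (m : Fin s → ℕ) (y : ℂ)
    (c : Fin r → ℂ) (j : Fin r) : ℂ :=
  kernelNumerator q a b h m (q / c j) * theta q (q / c j / y) *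
      (∏ i ∈ Finset.univ.erase j, theta q (c i)) /
    (kernelNumerator q a b h m 1 * theta q (1 / y) *
      ∏ i ∈ Finset.univ.erase j, theta q (c i * (q / c j)))

theorem kernelNumerator_one_ne_zero (hq1 : ‖q‖ < 1) (ha : ∀ i, a i ≠ 0)
    (hw : ScaledWellDefined q a b h m 1) : kernelNumerator q a b h m 1 ≠ 0 := by
  obtain ⟨h1, h2⟩ := hw
  refine mul_ne_zero (mul_ne_zero ?_ ?_) ?_ <;> refine Finset.prod_ne_zero_iff.mpr fun i _ => ?_
  · exact qInf_ne_zero hq1 (h2 (Sum.inl i))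
  · refine qInf_ne_zero hq1 fun n hn => h1 (Sum.inl i) n ?_
    have := ha i
    simp only [kmUpper, Sum.elim_inl]
    field_simp at hn ⊢
    rw [← hn, pow_succ']
  · rw [qPoch_natCast]
    exact Finset.prod_ne_zero_iff.mpr fun n _ => sub_ne_zero.mpr (h2 (Sum.inr i) n).symm

theorem theta_inv_ne_zero (hq0 : q ≠ 0) (hq1 : ‖q‖ < 1) (hy : ∀ n : ℤ, y ≠ q ^ n) :
    theta q (1 / y) ≠ 0 :=
  theta_ne_zero hq0 hq1 fun n hn => hy (-n) (by rw [zpow_neg, ← hn, one_div, inv_inv])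

theorem theta_mul_q_div_ne_zero (hq0 : q ≠ 0) (hq1 : ‖q‖ < 1)
    (hcc : ∀ i j, i ≠ j → ∀ n : ℤ, c i / c j ≠ q ^ n) {i j : Fin r} (hij : i ≠ j) :
    theta q (c i * (q / c j)) ≠ 0 :=
  theta_ne_zero hq0 hq1 fun n hn => hcc i j hij (n - 1) (by
    rw [zpow_sub_one₀ hq0, ← hn]
    field_simp)

/-- If some `c j` is an integer power of `q`, then the `j`-th series is a shift of the series with
unscaled parameters. -/
theorem tsum_scaledTerm_eq_of_eq_zpow (hq0 : q ≠ 0) (hq1 : ‖q‖ < 1) (ha : ∀ i, a i ≠ 0)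
    (hc : ∀ i, c i ≠ 0) (hz : z ≠ 0) (hcc : ∀ i j, i ≠ j → ∀ n : ℤ, c i / c j ≠ q ^ n)
    (hy : ∀ n : ℤ, y ≠ q ^ n) (hy0 : y ≠ 0) (hyz : y * ∏ i, c i = z * ∏ i, a i)
    (hw : ScaledWellDefined q a b h m 1) {j : Fin r}
    (hwj : ScaledWellDefined q a b h m (q / c j)) {e : ℤ} (he : q / c j = q ^ e) :
    ∑' n, scaledTerm q a b h m z 1 n =
      slaterCoeff q a b h m y c j * ∑' n, scaledTerm q a b h m z (q / c j) n := by
  classical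
  have hqp : 0 < ‖q‖ := norm_pos_iff.mpr hq0
  -- Any real `u` strictly between `‖q‖` and `1` avoids the powers of `q`.
  obtain ⟨u, hu0, hu⟩ : ∃ u : ℂ, u ≠ 0 ∧ ∀ n : ℤ, u ≠ q ^ n := by
    obtain ⟨t, ht1, ht2⟩ := exists_between hq1
    have ht0 : 0 < t := hqp.trans ht1
    refine ⟨t, by exact_mod_cast ht0.ne', fun n hn => ?_⟩
    have h1 : t = ‖q‖ ^ n := by
      rw [← norm_zpow, ← hn, Complex.norm_real, Real.norm_of_nonneg ht0.le]
    have hanti := zpow_right_strictAnti₀ hqp hq1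
    have h2 : n < 1 := hanti.lt_iff_gt.mp (show ‖q‖ ^ (1 : ℤ) < ‖q‖ ^ n by rwa [zpow_one, ← h1])
    have h3 : 0 < n := hanti.lt_iff_gt.mp (show ‖q‖ ^ n < ‖q‖ ^ (0 : ℤ) by rwa [zpow_zero, ← h1])
    omega
  have hcu : ∀ n : ℤ, c j / u ≠ q ^ n := fun n hn => by
    refine hu (1 - e - n) ?_
    rw [zpow_sub₀ hq0, zpow_sub₀ hq0, ← he, ← hn, zpow_one]
    have := hc j
    field_simp
  -- With `d = 1` both `θ(x)` and `θ(c j * x)` would vanish at every `q^k`. Taking `d = u` and `c j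
  -- / u` preserves the product `d ∏ c`, hence the recurrence, and makes the kernel finite at `q^k`.
  set c' := Function.update c j (c j / u) with hc'
  have hprod : ∀ G : ℂ → ℂ, ∏ i, G (c' i) = G (c j / u) * ∏ i ∈ Finset.univ.erase j, G (c i) := by
    intro G
    rw [← Finset.mul_prod_erase _ _ (Finset.mem_univ j), hc', Function.update_self]
    congr 1
    refine Finset.prod_congr rfl fun i hi => ?_
    rw [Function.update_of_ne (Finset.ne_of_mem_erase hi)]
  have hc'0 : ∀ i, c' i ≠ 0 := fun i => by
    rw [hc', Function.update_apply]
    split_ifs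
    exacts [div_ne_zero (hc j) hu0, hc i]
  have hyz' : y * u * ∏ i, c' i = z * ∏ i, a i := by
    rw [hprod (fun x => x), ← hyz, ← Finset.mul_prod_erase _ _ (Finset.mem_univ j)]
    field_simp
  set F := bilateralKernel q a b h m y u c' with hF
  have hFrec : ∀ k : ℤ, F (q ^ k) = F 1 * scaledTerm q a b h m z 1 k := by
    intro k
    have := eq_mul_psiTerm_of_recurrence (u := fun k => F (q ^ k)) hq0 hz hw (fun k => by
      have := bilateralKernel_q_mul (b := b) (h := h) (m := m) hq0 hq1 ha hc'0 hu0 hy0 hyz'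
        (zpow_ne_zero k hq0)
      simp only [mul_one, zpow_add_one₀ hq0, mul_comm _ q]
      exact this) k
    simp only [zpow_zero] at this
    exact this
  have hshift : ∀ n : ℤ, scaledTerm q a b h m z 1 (n + e) =
      scaledTerm q a b h m z 1 e * scaledTerm q a b h m z (q / c j) n := by
    intro n
    have := eq_mul_psiTerm_of_recurrence (u := fun n => scaledTerm q a b h m z 1 (n + e)) hq0 hz hwj
      (fun k => by
        have := psiTerm_add_one_mul hq0 hz hw (k + e)
        simp only [mul_one] at this
        simp only [scaledTerm, mul_one, mul_assoc, he, ← zpow_add₀ hq0]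
        rw [add_right_comm, add_comm e k, this, mul_assoc]) n
    simp only [zero_add] at this
    exact this
  have hcj : theta q (c j / u) ≠ 0 := theta_ne_zero hq0 hq1 hcu
  have hθu : theta q u ≠ 0 := theta_ne_zero hq0 hq1 hu
  have hci : ∏ i ∈ Finset.univ.erase j, theta q (c i) ≠ 0 :=
    Finset.prod_ne_zero_iff.mpr fun i hi => theta_ne_zero hq0 hq1 fun n hn => by
      refine hcc i j (Finset.ne_of_mem_erase hi) (n + e - 1) ?_
      rw [zpow_sub_one₀ hq0, zpow_add₀ hq0, ← he, hn]
      field_simp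
  have hnum := kernelNumerator_one_ne_zero hq1 ha hw
  have hθy := theta_inv_ne_zero hq0 hq1 hy
  have hF1 : F 1 = kernelNumerator q a b h m 1 * theta q (1 / y) *
      (theta q u * (theta q (c j / u) * ∏ i ∈ Finset.univ.erase j, theta q (c i)))⁻¹ := by
    simp only [hF, bilateralKernel, mul_one]
    rw [hprod (theta q)]
  have hFe : F (q ^ e) = kernelNumerator q a b h m (q / c j) * theta q (q / c j / y) *
      (theta q u * (theta q (c j / u) *
        ∏ i ∈ Finset.univ.erase j, theta q (c i * (q / c j))))⁻¹ := by
    simp only [hF, bilateralKernel, ← he]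
    rw [hprod fun x => theta q (x * (q / c j))]
    -- By `θ(q/x) = θ(x)`, moving from `1` to `q / c j` interchanges the two theta factors
    -- containing `u`; so `u` drops out of `F (q ^ e) / F 1`.
    have e1 : u * (q / c j) = q / (c j / u) := by
      have := hc j
      field_simp
    have e2 : c j / u * (q / c j) = q / u := by
      have := hc j
      field_simp
    rw [e1, e2, theta_q_div hq0, theta_q_div hq0]
    ring
  have hte : scaledTerm q a b h m z 1 e = slaterCoeff q a b h m y c j := by
    have h1 := hFrec e
    rw [hF1, hFe] at h1
    have hci' : ∏ i ∈ Finset.univ.erase j, theta q (c i * (q / c j)) ≠ 0 :=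
      Finset.prod_ne_zero_iff.mpr fun i hi =>
        theta_mul_q_div_ne_zero hq0 hq1 hcc (Finset.ne_of_mem_erase hi)
    rw [slaterCoeff, eq_div_iff (mul_ne_zero (mul_ne_zero hnum hθy) hci')]
    generalize ∏ i ∈ Finset.univ.erase j, theta q (c i * (q / c j)) = P at h1 hci' ⊢
    generalize theta q (q / c j / y) = t at h1 ⊢
    field_simp at h1
    linear_combination -h1
  rw [← (Equiv.addRight e).tsum_eq]
  simp only [Equiv.coe_addRight, hshift]
  rw [tsum_mul_left, hte]

/-- Slater's transformation when no `c j` is an integer power of `q`. -/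
theorem tsum_scaledTerm_eq_sum (hq0 : q ≠ 0) (hq1 : ‖q‖ < 1) (ha : ∀ i, a i ≠ 0)
    (hc : ∀ i, c i ≠ 0) (hz : z ≠ 0) (hcc : ∀ i j, i ≠ j → ∀ n : ℤ, c i / c j ≠ q ^ n)
    (hcq : ∀ i, ∀ n : ℤ, c i ≠ q ^ n)
    (hy : ∀ n : ℤ, y ≠ q ^ n) (hy0 : y ≠ 0) (hyz : y * ∏ i, c i = z * ∏ i, a i)
    (hw : ScaledWellDefined q a b h m 1) (hwj : ∀ j, ScaledWellDefined q a b h m (q / c j))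
    (hs : Summable (scaledTerm q a b h m z 1))
    (hsj : ∀ j, Summable (scaledTerm q a b h m z (q / c j)))
    (hup : ‖z‖ < 1) (hlow : ‖(∏ i, b i) * q ^ (-((∑ i, m i : ℕ) : ℤ)) / ∏ i, a i‖ < ‖z‖) :
    ∑' n, scaledTerm q a b h m z 1 n =
      ∑ j, slaterCoeff q a b h m y c j * ∑' n, scaledTerm q a b h m z (q / c j) n := by
  classical
  set F := bilateralKernel q a b h m y 1 c with hF
  have hrec : ∀ x, x ≠ 0 → F (q * x) * ∏ i, (1 - kmLower b h i * x) =
      z * (∏ i, (1 - kmUpper q a h m i * x)) * F x := fun x hx =>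
    bilateralKernel_q_mul hq0 hq1 ha hc one_ne_zero hy0 (by rw [mul_one, hyz]) hx
  set K := (qInf q q ^ 2)⁻¹ with hK
  have hres := tendsto_one_sub_mul_inv_theta hq1
  have hnumd : ∀ x : ℂ, x ≠ 0 →
      DifferentiableAt ℂ (fun x => kernelNumerator q a b h m x * theta q (x / y)) x := fun x hx =>
    (differentiableAt_kernelNumerator hq1 ha hx).mul
      (differentiableAt_theta hq1 (by fun_prop) (div_ne_zero hx hy0))
  have hcd : ∀ (S : Finset (Fin r)) (x : ℂ), x ≠ 0 →
      DifferentiableAt ℂ (fun x => ∏ i ∈ S, theta q (c i * x)) x := fun S x hx =>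
    DifferentiableAt.fun_finsetProd fun i _ =>
      differentiableAt_theta hq1 (by fun_prop) (mul_ne_zero (hc i) hx)
  have h1d : ∀ x : ℂ, x ≠ 0 → DifferentiableAt ℂ (fun x => theta q (1 * x)) x := fun x hx =>
    differentiableAt_theta hq1 (by fun_prop) (by simpa)
  have hqc0 : ∀ j, q / c j ≠ 0 := fun j => div_ne_zero hq0 (hc j)
  have hθc : ∏ i, theta q (c i) ≠ 0 :=
    Finset.prod_ne_zero_iff.mpr fun i _ => theta_ne_zero hq0 hq1 (hcq i)
  have hθcc : ∀ j, ∏ i ∈ Finset.univ.erase j, theta q (c i * (q / c j)) ≠ 0 := fun j =>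
    Finset.prod_ne_zero_iff.mpr fun i hi =>
      theta_mul_q_div_ne_zero hq0 hq1 hcc (Finset.ne_of_mem_erase hi)
  have hθcj : ∀ j, theta q (c j) ≠ 0 := fun j => theta_ne_zero hq0 hq1 (hcq j)
  have hlim1 : Tendsto (fun x => (1 - x / 1) * F x) (𝓝[≠] 1)
      (𝓝 (kernelNumerator q a b h m 1 * theta q (1 / y) * (∏ i, theta q (c i))⁻¹ * K)) := by
    have h1 : ContinuousAt (fun x => kernelNumerator q a b h m x * theta q (x / y) *
        (∏ i, theta q (c i * x))⁻¹) 1 :=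
      (hnumd 1 one_ne_zero).continuousAt.mul
        ((hcd Finset.univ 1 one_ne_zero).continuousAt.inv₀ (by simpa only [mul_one] using hθc))
    have h2 := (h1.tendsto.mono_left (nhdsWithin_le_nhds (s := {1}ᶜ))).mul hres
    simp only [mul_one] at h2
    refine h2.congr fun x => ?_
    rw [hF, bilateralKernel, mul_inv, one_mul, div_one]
    ring
  have hlimj : ∀ j, Tendsto (fun x => (1 - x / (q / c j)) * F x) (𝓝[≠] (q / c j))
      (𝓝 (-(kernelNumerator q a b h m (q / c j) * theta q (q / c j / y) *
        (theta q (c j) * ∏ i ∈ Finset.univ.erase j, theta q (c i * (q / c j)))⁻¹) * K)) := by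
    intro j
    have hθj : theta q (1 * (q / c j)) = theta q (c j) := by rw [one_mul, theta_q_div hq0]
    have hcj := hc j
    -- Quasi-periodicity rewrites `θ(c j * x)` through `θ(c j * x / q)`, whose argument is `1` at
    -- the pole. Its factor `-(c j * x / q)` tends to `-1`, the sign that puts these series on the
    -- other side of the formula.
    have h1 : ContinuousAt (fun x => -(c j * x / q) * (kernelNumerator q a b h m x *
        theta q (x / y) * (theta q (1 * x) *
          ∏ i ∈ Finset.univ.erase j, theta q (c i * x))⁻¹)) (q / c j) := by
      refine ContinuousAt.mul (by fun_prop) ((hnumd _ (hqc0 j)).continuousAt.mul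
        (((h1d _ (hqc0 j)).continuousAt.mul (hcd _ _ (hqc0 j)).continuousAt).inv₀ ?_))
      simp only [Pi.mul_apply]
      exact mul_ne_zero (hθj ▸ hθcj j) (hθcc j)
    have h2 : Tendsto (fun x => c j * x / q) (𝓝[≠] (q / c j)) (𝓝[≠] 1) := by
      refine tendsto_nhdsWithin_of_tendsto_nhds_of_eventually_within _ ?_ ?_
      · have : ContinuousAt (fun x => c j * x / q) (q / c j) := by fun_prop
        have h3 := this.tendsto
        rw [mul_div_cancel₀ _ hcj, div_self hq0] at h3
        exact h3.mono_left nhdsWithin_le_nhds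
      · filter_upwards [self_mem_nhdsWithin] with x hx hx1
        refine hx ?_
        have hx1 : c j * x / q = 1 := hx1
        rw [Set.mem_singleton_iff, eq_div_iff hcj, mul_comm]
        exact (div_eq_one_iff_eq hq0).mp hx1
    have h3 := (h1.tendsto.mono_left (nhdsWithin_le_nhds (s := {q / c j}ᶜ))).mul (hres.comp h2)
    rw [mul_div_cancel₀ _ hcj, div_self hq0, hθj, neg_one_mul] at h3
    refine h3.congr' ?_
    filter_upwards [(isOpen_ne.eventually_mem (hqc0 j)).filter_mono nhdsWithin_le_nhds] with x hx0
    have hx0 : x ≠ 0 := hx0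
    have e1 : theta q (c j * x) = -(c j * x / q)⁻¹ * theta q (c j * x / q) := by
      rw [← theta_q_mul hq0 hq1 (div_ne_zero (mul_ne_zero hcj hx0) hq0), mul_div_cancel₀ _ hq0]
    have e2 : x / (q / c j) = c j * x / q := by field_simp
    rw [hF, bilateralKernel, ← Finset.mul_prod_erase _ _ (Finset.mem_univ j), e1, e2]
    simp only [Function.comp_apply, mul_inv, inv_neg, inv_inv]
    ring
  -- `none` is the family through `1`, giving the left-hand series; `some j` is the one through `q /
  -- c j`.
  let p : Option (Fin r) → ℂ := fun o => o.elim 1 fun j => q / c j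
  let w₀ : Option (Fin r) → ℂ := fun o => o.elim
    (kernelNumerator q a b h m 1 * theta q (1 / y) * (∏ i, theta q (c i))⁻¹ * K)
    fun j => -(kernelNumerator q a b h m (q / c j) * theta q (q / c j / y) *
        (theta q (c j) * ∏ i ∈ Finset.univ.erase j, theta q (c i * (q / c j)))⁻¹) * K
  have hp0 : ∀ o, p o ≠ 0 := by
    rintro (_ | j)
    exacts [one_ne_zero, hqc0 j]
  have hwp : ∀ o, ScaledWellDefined q a b h m (p o) := by
    rintro (_ | j)
    exacts [hw, hwj j]
  have hlim0 : ∀ o, Tendsto (fun x => (1 - x / p o) * F x) (𝓝[≠] (p o)) (𝓝 (w₀ o)) := by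
    rintro (_ | j)
    exacts [hlim1, hlimj j]
  have hsp : ∀ o, Summable (scaledTerm q a b h m z (p o)) := by
    rintro (_ | j)
    exacts [hs, hsj j]
  obtain ⟨l, hl, hlt⟩ := exists_tendsto_lower_div_upper (b := b) (h := h) (m := m) hq0 hq1 ha
  have key := sum_tsum_residues_eq_zero (φ := F) (p := p)
    (w := fun o n => w₀ o * scaledTerm q a b h m z (p o) n) hq0 hq1 hp0
    (by
      rintro (_ | i) (_ | j) hij n hn
      · exact hij rfl
      · refine hcq j (n + 1) ?_
        have hn : 1 = q / c j * q ^ n := hn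
        have := hc j
        rw [zpow_add_one₀ hq0]
        field_simp at hn
        rw [hn]
        ring
      · refine hcq i (1 - n) ?_
        have hn : q / c i = 1 * q ^ n := hn
        rw [zpow_sub₀ hq0, zpow_one, ← one_mul (q ^ n), ← hn, div_div_cancel₀ hq0]
      · refine hcc j i (fun e => hij (by rw [e])) n ?_
        have hn : q / c i = q / c j * q ^ n := hn
        have h1 := hc i
        have h2 := hc j
        field_simp at hn ⊢
        exact hn)
    (fun x hx hxp => by
      refine (hnumd x hx).mul (((h1d x hx).mul (hcd Finset.univ x hx)).inv (mul_ne_zero ?_ ?_))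
      · refine theta_ne_zero hq0 hq1 fun n hn => hxp none n ?_
        simpa [p] using hn
      · refine Finset.prod_ne_zero_iff.mpr fun i _ => theta_ne_zero hq0 hq1 fun n hn =>
          hxp (some i) (n - 1) ?_
        have := hc i
        simp only [p, Option.elim_some]
        rw [zpow_sub_one₀ hq0, ← hn]
        field_simp)
    (fun o n => tendsto_one_sub_div_mul_of_recurrence hq0 hz (hp0 o) (hwp o) hrec (hlim0 o) n)
    (fun o => (hsp o).mul_left _)
    (by
      obtain ⟨C, hC, hev⟩ := exists_contraction_nhds_zero (A := kmUpper q a h m)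
        (B := kmLower b h) hup
      obtain ⟨δ, hδ, hball⟩ := Metric.eventually_nhds_iff.mp hev
      exact ⟨δ, hδ, C, hC, fun x hx hxδ => hball (by simpa using hxδ) _ _ (hrec x hx)⟩)
    (by
      obtain ⟨C, hC, hev⟩ := exists_contraction_cobounded (hl.trans_lt hlow) hlt
      obtain ⟨M, -, hM⟩ := hasBasis_cobounded_norm.eventually_iff.mp hev
      refine ⟨max M 0, C, hC, fun x hx => hM (le_max_left M 0 |>.trans hx.le) _ _ (hrec x ?_)⟩
      exact norm_pos_iff.mp ((le_max_right M 0).trans_lt hx))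
  simp only [tsum_mul_left, Fintype.sum_option] at key
  have hnum := kernelNumerator_one_ne_zero hq1 ha hw
  have hθy := theta_inv_ne_zero hq0 hq1 hy
  have hw0 : w₀ none ≠ 0 := by
    refine mul_ne_zero (mul_ne_zero (mul_ne_zero hnum hθy) (inv_ne_zero hθc)) ?_
    refine inv_ne_zero (pow_ne_zero 2 (qInf_ne_zero hq1 fun n hn => ?_))
    have h1 : ‖q * q ^ n‖ = 1 := by rw [hn, norm_one]
    rw [← pow_succ', norm_pow] at h1
    exact (pow_lt_one₀ (norm_nonneg q) hq1 n.succ_ne_zero).ne h1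
  have hcoeff : ∀ j, w₀ (some j) = -w₀ none * slaterCoeff q a b h m y c j := by
    intro j
    simp only [w₀, Option.elim_some, Option.elim_none, slaterCoeff]
    rw [← Finset.mul_prod_erase _ (fun i => theta q (c i)) (Finset.mem_univ j)] at hθc ⊢
    have h1 := hθcj j
    have h2 := right_ne_zero_of_mul hθc
    have h3 := hθcc j
    field_simp
  simp only [hcoeff, mul_assoc, neg_mul] at key
  rw [Finset.sum_neg_distrib, ← Finset.mul_sum, ← sub_eq_add_neg, ← mul_sub] at key
  exact sub_eq_zero.mp ((mul_eq_zero.mp key).resolve_left hw0)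

end Slater

/-! ### Matching the stated coefficients, degenerate and terminating cases -/

variable {r s : ℕ} {q : ℂ} {a b c : Fin r → ℂ} {h : Fin s → ℂ} {m : Fin s → ℕ} {y z : ℂ}

theorem shiftedUpper_eq (q : ℂ) (a : Fin r → ℂ) (h : Fin s → ℂ) (m : Fin s → ℕ) (x : ℂ) :
    shiftedUpper q a h m x = fun i => kmUpper q a h m i * (q / x) := by
  funext i
  cases i with
  | inl i => exact mul_div_assoc _ _ _
  | inr i =>
    simp only [shiftedUpper, kmUpper, Sum.elim_inr, pow_add, pow_one]
    ring

theorem shiftedLower_eq (q : ℂ) (b : Fin r → ℂ) (h : Fin s → ℂ) (x : ℂ) :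
    shiftedLower q b h x = fun i => kmLower b h i * (q / x) := by
  funext i
  cases i <;> exact mul_div_assoc _ _ _

theorem slaterCoeff_comp_swap [NeZero r] (k : Fin r) :
    slaterCoeff q a b h m y (c ∘ Equiv.swap 0 k) 0 = slaterCoeff q a b h m y c k := by
  have hprod : ∀ G : ℂ → ℂ, ∏ i ∈ Finset.univ.erase (0 : Fin r), G ((c ∘ Equiv.swap 0 k) i) =
      ∏ i ∈ Finset.univ.erase k, G (c i) := fun G =>
    Finset.prod_equiv (Equiv.swap 0 k)
      (fun i => by simp [← (Equiv.swap 0 k).injective.ne_iff (x := i) (y := 0)])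
      (fun i _ => rfl)
  have h0 : (c ∘ Equiv.swap 0 k) 0 = c k := by simp
  rw [slaterCoeff, slaterCoeff, hprod (theta q), h0, hprod fun x => theta q (x * (q / c k))]

/-- With `Y = Az`, the products pair up into thetas: `c_i, q/c_i` into `θ(c_i)`, `c_1/c_i, c_i
q/c_1` into `θ(c_i q/c_1)`, `A c_1 z, q/(A c_1 z)` into `θ(q/(c_1 Y))`, and `Azq, 1/(Az)` into
`θ(1/Y)`. The rest are kernel numerators at `q/c_1` and `1`. -/
theorem prefactor_eq_slaterCoeff [NeZero r] (hq0 : q ≠ 0) (d : Fin r → ℂ) :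
    prefactor q a b h m z d =
      slaterCoeff q a b h m ((∏ i, a i) / (∏ i, d i) * z) d 0 := by
  have e1 : ∀ x : ℂ, ∏ i, qInf (b i * q / x) q = ∏ i, qInf (b i * (q / x)) q := fun x => by
    simp only [mul_div_assoc]
  have e2 : ∏ i, qInf (q / (a i * (q / d 0))) q = ∏ i, qInf (d 0 / a i) q :=
    Finset.prod_congr rfl fun i _ => by
      congr 1
      rw [mul_comm (a i), ← div_div, div_div_cancel₀ hq0]
  have e3 : ∀ i, theta q (d i * (q / d 0)) = qInf (d 0 / d i) q * qInf (d i * q / d 0) q :=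
    fun i => by
      rw [theta, mul_comm (d i), ← div_div, div_div_cancel₀ hq0, mul_comm, div_mul_eq_mul_div,
        mul_comm q]
  set Y := (∏ i, a i) / (∏ i, d i) * z with hY
  have e4 : theta q (q / d 0 / Y) = qInf ((∏ i, a i) / (∏ i, d i) * d 0 * z) q *
      qInf (q / ((∏ i, a i) / (∏ i, d i) * d 0 * z)) q := by
    rw [div_div, theta_q_div hq0, theta, hY]
    congr 2 <;> ring
  have e5 : theta q (1 / Y) = qInf (Y * q) q * qInf (1 / Y) q := by
    rw [theta, div_div_eq_mul_div, div_one, mul_comm q, mul_comm]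
  simp only [prefactor, slaterCoeff, kernelNumerator, mul_one, e2, e3, e4, e5,
    Finset.prod_mul_distrib, Finset.prod_div_distrib, mul_div_assoc]
  simp only [theta, Finset.prod_mul_distrib, ← mul_div_assoc, ← hY]
  simp only [div_eq_mul_inv, mul_inv]
  ring

theorem slaterCoeff_eq_zero (hq0 : q ≠ 0) (hq1 : ‖q‖ < 1) {j k : Fin r} (hjk : j ≠ k) {n : ℤ}
    (hj : c j = q ^ n) : slaterCoeff q a b h m y c k = 0 := by
  have : ∏ i ∈ Finset.univ.erase k, theta q (c i) = 0 :=
    Finset.prod_eq_zero (Finset.mem_erase.mpr ⟨hjk, Finset.mem_univ j⟩) (by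
      rw [hj, theta_zpow hq0 hq1])
  rw [slaterCoeff, this, mul_zero, zero_div]

/-- If all series terminate in the same direction, some `c j` is an integer power of `q`. -/
theorem exists_eq_zpow_of_forall_exists (hq0 : q ≠ 0) (hc : ∀ i, c i ≠ 0)
    (hcc : ∀ i j, i ≠ j → ∀ n : ℤ, c i / c j ≠ q ^ n) {f : Fin r → ℂ}
    (h1 : ∃ i, ∃ n : ℤ, f i = q ^ n) (hj : ∀ j, ∃ i, ∃ n : ℤ, f i * (q / c j) = q ^ n) :
    ∃ j, ∃ n : ℤ, c j = q ^ n := by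
  -- If `σ i = σ j` then `c i / c j` is a power of `q`; so `σ` is injective, hence onto, and reaches
  -- the index whose parameter is itself a power of `q`.
  choose σ e hσ using hj
  have hf : ∀ j, f (σ j) = c j * q ^ (e j - 1) := fun j => by
    have := hc j
    rw [zpow_sub_one₀ hq0, ← hσ j]
    field_simp
  have hinj : Function.Injective σ := by
    intro i j hij
    by_contra hne
    refine hcc i j hne (e j - e i) ?_
    have h2 := hf i
    rw [hij, hf j, zpow_sub_one₀ hq0, zpow_sub_one₀ hq0] at h2
    have := hc j
    rw [zpow_sub₀ hq0, div_eq_div_iff this (zpow_ne_zero _ hq0)]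
    field_simp at h2
    linear_combination -h2
  obtain ⟨i, n, hn⟩ := h1
  obtain ⟨j, rfl⟩ := (Finite.surjective_of_injective hinj) i
  refine ⟨j, n - (e j - 1), ?_⟩
  rw [zpow_sub₀ hq0, ← hn, hf, mul_div_cancel_right₀ _ (zpow_ne_zero _ hq0)]

/-- A parameter `h i * q ^ m i` cannot cause termination: the vanishing factor would be one of the
lower parameter `h i`, against well-definedness. -/
theorem exists_zpow_of_terminatesAbove (hq0 : q ≠ 0) (hz : z ≠ 0) {p : ℂ}
    (hw : ScaledWellDefined q a b h m p) (ht : TerminatesAbove (scaledTerm q a b h m z p)) :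
    ∃ i, ∃ n : ℤ, a i * p = q ^ n := by
  obtain ⟨i | i, n, hn⟩ := exists_upper_of_terminatesAbove hq0 hz hw ht
  · refine ⟨i, -(n : ℤ), ?_⟩
    rw [zpow_neg, zpow_natCast]
    exact eq_inv_of_mul_eq_one_left hn
  · refine absurd ?_ (hw.2 (Sum.inr i) (m i + n))
    simp only [kmUpper, kmLower, Sum.elim_inr] at hn ⊢
    rw [pow_add, ← hn]
    ring

theorem exists_zpow_of_terminatesBelow (hq0 : q ≠ 0) (hz : z ≠ 0) {p : ℂ}
    (hw : ScaledWellDefined q a b h m p) (ht : TerminatesBelow (scaledTerm q a b h m z p)) :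
    ∃ i, ∃ n : ℤ, b i * p = q ^ n := by
  obtain ⟨i | i, n, hn⟩ := exists_lower_of_terminatesBelow hq0 hz hw ht
  · exact ⟨i, (n + 1 : ℕ), by rw [zpow_natCast]; exact hn⟩
  · refine absurd ?_ (hw.1 (Sum.inr i) (m i + n))
    simp only [kmUpper, kmLower, Sum.elim_inr] at hn ⊢
    rw [add_assoc, pow_add, ← hn]
    ring

theorem addIdem_eq_sum [NeZero r] {T : (Fin r → ℂ) → ℂ} {S : Fin r → ℂ}
    (hT : ∀ k, T (c ∘ Equiv.swap 0 k) = S k) : addIdem T c = ∑ k, S k := by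
  rw [addIdem, Finset.sum_congr rfl fun k _ => hT k,
    ← Finset.add_sum_erase _ S (Finset.mem_univ 0), ← hT 0]
  simp

end ChuGasper

open ChuGasper in
theorem mainTheorem1 {r s : ℕ} [NeZero r] (q : ℂ) (hq0 : 0 < ‖q‖) (hq1 : ‖q‖ < 1)
    (a b c : Fin r → ℂ) (h : Fin s → ℂ) (m : Fin s → ℕ) (z : ℂ)
    (ha : ∀ i, a i ≠ 0) (hc : ∀ i, c i ≠ 0) (hz : z ≠ 0)
    -- the products in the denominators of the coefficients on the right do not vanish
    (hcc : ∀ i j, i ≠ j → ∀ n : ℤ, c i / c j ≠ q ^ n)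
    (hA : ∀ n : ℤ, ((∏ i, a i) / ∏ i, c i) * z ≠ q ^ n)
    -- the series are well-defined
    (hL : ChuGasper.PsiWellDefined q (ChuGasper.kmUpper q a h m) (ChuGasper.kmLower b h))
    (hR : ∀ j, ChuGasper.PsiWellDefined q (ChuGasper.shiftedUpper q a h m (c j))
      (ChuGasper.shiftedLower q b h (c j)))
    -- the convergence condition, in each of the two directions of summation
    (hup : ‖z‖ < 1 ∨
      (ChuGasper.TerminatesAbove
          (ChuGasper.psiTerm q (ChuGasper.kmUpper q a h m) (ChuGasper.kmLower b h) z) ∧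
        ∀ j, ChuGasper.TerminatesAbove
          (ChuGasper.psiTerm q (ChuGasper.shiftedUpper q a h m (c j))
            (ChuGasper.shiftedLower q b h (c j)) z)))
    (hlow : ‖(∏ i, b i) * q ^ (-((∑ i, m i : ℕ) : ℤ)) / ∏ i, a i‖ < ‖z‖ ∨
      (ChuGasper.TerminatesBelow
          (ChuGasper.psiTerm q (ChuGasper.kmUpper q a h m) (ChuGasper.kmLower b h) z) ∧
        ∀ j, ChuGasper.TerminatesBelow
          (ChuGasper.psiTerm q (ChuGasper.shiftedUpper q a h m (c j))
            (ChuGasper.shiftedLower q b h (c j)) z))) :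
    Summable (ChuGasper.psiTerm q (ChuGasper.kmUpper q a h m) (ChuGasper.kmLower b h) z) ∧
    (∀ j, Summable (ChuGasper.psiTerm q (ChuGasper.shiftedUpper q a h m (c j))
      (ChuGasper.shiftedLower q b h (c j)) z)) ∧
    ChuGasper.psi q (ChuGasper.kmUpper q a h m) (ChuGasper.kmLower b h) z =
      ChuGasper.addIdem
        (fun d : Fin r → ℂ =>
          ChuGasper.prefactor q a b h m z d *
            ChuGasper.psi q (ChuGasper.shiftedUpper q a h m (d 0))
              (ChuGasper.shiftedLower q b h (d 0)) z) c := by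
  have hq : q ≠ 0 := norm_pos_iff.mp hq0
  have tL : psiTerm q (kmUpper q a h m) (kmLower b h) z = scaledTerm q a b h m z 1 := by
    simp [scaledTerm]
  have tR : ∀ x, psiTerm q (shiftedUpper q a h m x) (shiftedLower q b h x) z =
      scaledTerm q a b h m z (q / x) := fun x => by
    rw [shiftedUpper_eq, shiftedLower_eq, scaledTerm]
  have hw : ScaledWellDefined q a b h m 1 := by simpa [ScaledWellDefined] using hL
  have hwj : ∀ j, ScaledWellDefined q a b h m (q / c j) := fun j => by
    have := hR j
    rw [shiftedUpper_eq, shiftedLower_eq] at this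
    exact this
  simp only [psi, tL, tR] at hup hlow ⊢
  have hqc : ∀ j, q / c j ≠ 0 := fun j => div_ne_zero hq (hc j)
  obtain ⟨l, hl, hlt⟩ := exists_tendsto_lower_div_upper (b := b) (h := h) (m := m) hq hq1 ha
  -- In `ℂ`, `Summable` is absolute convergence.
  have hs : Summable (scaledTerm q a b h m z 1) :=
    summable_psiTerm hq hq1 hz one_ne_zero hw (hup.imp_right fun t => t.1) hlt
      (hlow.imp (fun t => hl.trans_lt t) fun t => t.1)
  have hsj : ∀ j, Summable (scaledTerm q a b h m z (q / c j)) := fun j =>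
    summable_psiTerm hq hq1 hz (hqc j) (hwj j) (hup.imp_right fun t => t.2 j) hlt
      (hlow.imp (fun t => hl.trans_lt t) fun t => t.2 j)
  refine ⟨hs, hsj, ?_⟩
  set y := (∏ i, a i) / (∏ i, c i) * z with hy
  have ha' : ∏ i, a i ≠ 0 := Finset.prod_ne_zero_iff.mpr fun i _ => ha i
  have hc' : ∏ i, c i ≠ 0 := Finset.prod_ne_zero_iff.mpr fun i _ => hc i
  have hy0 : y ≠ 0 := mul_ne_zero (div_ne_zero ha' hc') hz
  have hyz : y * ∏ i, c i = z * ∏ i, a i := by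
    rw [hy]
    field_simp
  -- Interchanging `c_1` with `c_k` leaves `∏ c_i`, and so `y`, unchanged.
  rw [addIdem_eq_sum (S := fun k => slaterCoeff q a b h m y c k *
    ∑' n, scaledTerm q a b h m z (q / c k) n) fun k => by
      have h1 : ∏ i, (c ∘ Equiv.swap 0 k) i = ∏ i, c i := Equiv.prod_comp _ c
      rw [prefactor_eq_slaterCoeff hq, h1, ← hy, slaterCoeff_comp_swap]
      simp]
  by_cases hcq : ∃ j, ∃ n : ℤ, c j = q ^ n
  · obtain ⟨j, n, hj⟩ := hcq
    have he : q / c j = q ^ (1 - n) := by rw [hj, zpow_sub₀ hq, zpow_one]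
    rw [Finset.sum_eq_single j
      (fun k _ hk => by rw [slaterCoeff_eq_zero hq hq1 hk.symm hj, zero_mul]) (by simp)]
    exact tsum_scaledTerm_eq_of_eq_zpow hq hq1 ha hc hz hcc hA hy0 hyz hw (hwj j) he
  -- With no `c j` a power of `q`, common termination in either direction is impossible, so both
  -- bounds on `‖z‖` hold.
  · rcases hup with hup | ⟨t, tj⟩
    · rcases hlow with hlow | ⟨t, tj⟩
      · push Not at hcq
        exact tsum_scaledTerm_eq_sum hq hq1 ha hc hz hcc hcq hA hy0 hyz hw hwj hs hsj hup hlow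
      · exact absurd (exists_eq_zpow_of_forall_exists hq hc hcc
          (by simpa using exists_zpow_of_terminatesBelow hq hz hw t)
          fun j => exists_zpow_of_terminatesBelow hq hz (hwj j) (tj j)) hcq
    · exact absurd (exists_eq_zpow_of_forall_exists hq hc hcc
        (by simpa using exists_zpow_of_terminatesAbove hq hz hw t)
        fun j => exists_zpow_of_terminatesAbove hq hz (hwj j) (tj j)) hcq
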